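/- Let $X$ be a complex Banach space, let $k\ge 1$ be an integer and $n=2k+1$. For an integrable function $F:\mathbb R^n\to X$ put $$\hat F(\xi)=\int_{\mathbb R^n}e^{-i\xi\cdot s}F(s)\,ds,\qquad S_R(F)(x)=\frac1{(2\pi)^n}\int_{|\xi|\le R}e^{ix\cdot\xi}\hat F(\xi)\,d\xi ,$$ and, when $F$ is also continuous, let $$\bar F_x(r)=\frac1{\omega_{n-1}}\int_{\mathbb S^{n-1}}F(x+r\omega)\,d\omega\qquad(x\in\mathbb R^n,\ r\ge 0)$$ be the spherical mean of $F$ about $x$, where $\mathbb S^{n-1}$ is the unit sphere of $\mathbb R^n$, $d\omega$ its surface measure and $\omega_{n-1}$ its total surface area. Let $K\subset\mathbb R^n$ be compact, and let $F:\mathbb R^n\to X$ be integrable and $k$ times continuously differentiable. Suppose that for some $\delta>0$ the set $$\Big\{\,r\mapsto \frac{\bar F_x(r)-\mathbf 1_{(0,\delta)}(r)F(x)}{r}\;:\;x\in K\Big\}$$ is a compact subset of $L^1((0,\infty);X)$, and that for each $j=1,\dots,k$ the set $$\Big\{\,r\mapsto r^{\,j-1}\Big(\frac{d}{dr}\Big)^{l}\bar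 F_x(r)\;:\;x\in K,\ l=0,\dots,j\Big\}$$ is a compact subset of $L^1((0,\infty);X)$. Then Fourier inversion holds uniformly on $K$, that is, $$\lim_{R\to\infty}\ \sup_{x\in K}\ \|S_R(F)(x)-F(x)\|_X=0 .$$ -/

import Mathlib

open MeasureTheory Set Filter Topology

noncomputable section

/-- The surface measure on the unit sphere of `ℝⁿ`. -/
def sphereMeasure (n : ℕ) :
    Measure (Metric.sphere (0 : EuclideanSpace ℝ (Fin n)) 1) :=
  (volume : Measure (EuclideanSpace ℝ (Fin n))).toSphere

/-- The spherical mean `r ↦ ω_{n-1}⁻¹ ∫_{𝕊^{n-1}} F (x + r ω) dω` of `F` about `x`. -/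
def sphericalMean {X : Type*} [NormedAddCommGroup X] [NormedSpace ℂ X] {n : ℕ}
    (F : EuclideanSpace ℝ (Fin n) → X) (x : EuclideanSpace ℝ (Fin n)) (r : ℝ) : X :=
  ((sphereMeasure n).real univ)⁻¹ •
    ∫ w, F (x + r • (w : EuclideanSpace ℝ (Fin n))) ∂(sphereMeasure n)

/-- The Fourier transform `ξ ↦ ∫ e^{-i ξ·s} F(s) ds`. -/
def fourierHat {X : Type*} [NormedAddCommGroup X] [NormedSpace ℂ X] {n : ℕ}
    (F : EuclideanSpace ℝ (Fin n) → X) (ξ : EuclideanSpace ℝ (Fin n)) : X :=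
  ∫ s, Complex.exp (-(Complex.I * ((inner ℝ ξ s : ℝ) : ℂ))) • F s

/-- The truncated inversion integral
`S_R(F)(x) = (2π)⁻ⁿ ∫_{|ξ| ≤ R} e^{i x·ξ} (fourierHat F)(ξ) dξ`. -/
def fourierPartial {X : Type*} [NormedAddCommGroup X] [NormedSpace ℂ X] {n : ℕ}
    (R : ℝ) (F : EuclideanSpace ℝ (Fin n) → X) (x : EuclideanSpace ℝ (Fin n)) : X :=
  (((2 * Real.pi) ^ n)⁻¹ : ℝ) •
    ∫ ξ in Metric.closedBall (0 : EuclideanSpace ℝ (Fin n)) R,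
      Complex.exp (Complex.I * ((inner ℝ x ξ : ℝ) : ℂ)) • fourierHat F ξ

/-- Fourier inversion holds uniformly on `K`: `S_R(F) → F` uniformly on `K` as `R → ∞`. -/
def FourierInversionUniformlyOn {X : Type*} [NormedAddCommGroup X] [NormedSpace ℂ X] {n : ℕ}
    (F : EuclideanSpace ℝ (Fin n) → X) (K : Set (EuclideanSpace ℝ (Fin n))) : Prop :=
  TendstoUniformlyOn (fun R : ℝ => fourierPartial R F) F atTop K

/-- A set `S` of functions `ℝ → X`, restricted to `(0,∞)`, is a compact subset of
`L¹((0,∞);X)`: every member is integrable there, and the set of the corresponding classes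
is compact for the `L¹` norm. -/
def IsCompactInL1 {X : Type*} [NormedAddCommGroup X] [NormedSpace ℂ X]
    (S : Set (ℝ → X)) : Prop :=
  (∀ g ∈ S, IntegrableOn g (Ioi 0)) ∧
    IsCompact {f : Lp X 1 ((volume : Measure ℝ).restrict (Ioi 0)) |
      ∃ g ∈ S, (f : ℝ → X) =ᵐ[(volume : Measure ℝ).restrict (Ioi 0)] g}

end

/-!
In odd dimension `n = 2 k + 1` the spherical Dirichlet kernel is radial with an explicit profile, a
multiple of `∫_{-R}^R (R² - t²)ᵏ cos (t r) dt`, so in polar coordinates `S_R F (x)` is the integral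
of this profile against `r ^ (2 k)` times the spherical mean of `F` about `x`. Since
`d/dr ∫_{-R}^R (R² - t²)ᵖ cos (t r) dt` is a multiple of `r ∫_{-R}^R (R² - t²)ᵖ⁺¹ cos (t r) dt`,
`k` integrations by parts reduce the kernel to `∫_{-R}^R cos (t r) dt = 2 sin (R r) / r`, at the
cost of replacing the spherical mean `f` by a combination of `f, r f', …, r ^ k f⁽ᵏ⁾`. Splitting
`𝟙_{(0, δ)} F(x)` off the term in `f`, what remains is a Dirichlet integral, which tends to
`F(x)`, and sine transforms of functions that are integrable on the half line. These tend to zero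
by the Riemann–Lebesgue lemma, uniformly over a precompact set because the sine transforms are
uniformly Lipschitz on `L¹`. Precompactness also makes `F` bounded on `K`, so the Dirichlet
integral term converges uniformly too.
-/

open scoped Uniformity
open Asymptotics

section UniformConvergence

theorem tendstoUniformlyOn_of_uniformEquicontinuous {ι α β : Type*} [UniformSpace α]
    [UniformSpace β] {Φ : ι → α → β} {φ : α → β} {l : Filter ι} [l.NeBot] {S : Set α}
    (hΦ : UniformEquicontinuous Φ) (hlim : ∀ a, Tendsto (fun i => Φ i a) l (𝓝 (φ a)))
    (hS : TotallyBounded S) :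
    TendstoUniformlyOn Φ φ l S := by
  have hφ : UniformContinuous φ :=
    (tendsto_pi_nhds.2 hlim).uniformContinuous_of_uniformEquicontinuous hΦ
  intro U hU
  obtain ⟨V, hV, hVsymm, hVU⟩ := comp_comp_symm_mem_uniformity_sets hU
  obtain ⟨t, ht, hcover⟩ := hS _ (inter_mem (hΦ V hV) (hφ hV))
  have hnet : ∀ᶠ i in l, ∀ y ∈ t, (φ y, Φ i y) ∈ V :=
    (eventually_all_finite ht).2 fun y _ => Uniform.tendsto_nhds_right.1 (hlim y) hV
  filter_upwards [hnet] with i hi a ha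
  obtain ⟨y, hy, hay, hφay⟩ := mem_iUnion₂.1 (hcover ha)
  exact hVU ⟨Φ i y, ⟨φ y, hφay, hi y hy⟩, SetRel.symm V (hay i)⟩

variable {ι α 𝕜 E : Type*} [NormedField 𝕜] [SeminormedAddCommGroup E] [NormedSpace 𝕜 E]
  {l : Filter ι} {S : Set α}

theorem tendstoUniformlyOn_smul_const {c : ι → 𝕜} {c₀ : 𝕜} {F : α → E} {M : ℝ}
    (hF : ∀ x ∈ S, ‖F x‖ ≤ M) (hc : Tendsto c l (𝓝 c₀)) :
    TendstoUniformlyOn (fun i x => c i • F x) (fun x => c₀ • F x) l S := by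
  have hlim : Tendsto (fun i => ‖c i - c₀‖ * M) l (𝓝 0) := by
    simpa using (hc.sub_const c₀).norm.mul_const M
  rw [Metric.tendstoUniformlyOn_iff]
  intro ε hε
  filter_upwards [hlim.eventually_lt_const hε] with i hi x hx
  calc dist (c₀ • F x) (c i • F x) = ‖(c i - c₀) • F x‖ := by
        rw [dist_comm, dist_eq_norm, sub_smul]
    _ ≤ ‖c i - c₀‖ * M := by rw [norm_smul]; gcongr; exact hF x hx
    _ < ε := hi

theorem tendstoUniformlyOn_finset_sum {κ : Type*} (s : Finset κ) {f : κ → ι → α → E}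
    {g : κ → α → E} (hf : ∀ j ∈ s, TendstoUniformlyOn (f j) (g j) l S) :
    TendstoUniformlyOn (fun i x => ∑ j ∈ s, f j i x) (fun x => ∑ j ∈ s, g j x) l S := by
  induction s using Finset.cons_induction with
  | empty => exact tendsto_const_nhds.tendstoUniformlyOn_const S
  | cons j s hj ih =>
    simp only [Finset.sum_cons]
    exact (hf j (Finset.mem_cons_self j s)).add
      (ih fun i hi => hf i (Finset.mem_cons_of_mem hi))

end UniformConvergence

section SineTransform

variable {E : Type*} [NormedAddCommGroup E]

/-- A set `S` of functions on `ℝ`, restricted to `(0, ∞)`, is precompact in `L¹((0, ∞); E)`: the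
counterpart of `IsCompactInL1` with total boundedness in place of compactness. -/
def IsPrecompactInL1 (S : Set (ℝ → E)) : Prop :=
  (∀ g ∈ S, IntegrableOn g (Ioi 0)) ∧
    TotallyBounded {f : Lp E 1 ((volume : Measure ℝ).restrict (Ioi 0)) |
      ∃ g ∈ S, (f : ℝ → E) =ᵐ[(volume : Measure ℝ).restrict (Ioi 0)] g}

theorem IsCompactInL1.isPrecompactInL1 [NormedSpace ℂ E] {S : Set (ℝ → E)}
    (hS : IsCompactInL1 S) : IsPrecompactInL1 S :=
  ⟨hS.1, hS.2.totallyBounded⟩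

namespace IsPrecompactInL1

theorem mono {S T : Set (ℝ → E)} (hT : IsPrecompactInL1 T) (hST : S ⊆ T) : IsPrecompactInL1 S :=
  ⟨fun g hg => hT.1 g (hST hg),
    hT.2.subset (ofPred_subset_ofPred.2 fun _ ⟨g, hg, hfg⟩ => ⟨g, hST hg, hfg⟩)⟩

theorem exists_integral_norm_le {S : Set (ℝ → E)} (hS : IsPrecompactInL1 S) :
    ∃ C, ∀ g ∈ S, ∫ r in Ioi 0, ‖g r‖ ≤ C := by
  obtain ⟨C, hC⟩ := hS.2.isBounded.exists_norm_le
  refine ⟨C, fun g hg => ?_⟩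
  rw [← L1.norm_of_fun_eq_integral_norm (hS.1 g hg)]
  exact hC _ ⟨g, hg, (hS.1 g hg).coeFn_toL1⟩

end IsPrecompactInL1

theorem integrable_sin_smul [NormedSpace ℝ E] {μ : Measure ℝ} {g : ℝ → E} (hg : Integrable g μ)
    (R : ℝ) : Integrable (fun r => Real.sin (R * r) • g r) μ :=
  hg.bdd_smul 1 (by fun_prop) (.of_forall fun r => Real.abs_sin_le_one _)

/-- The sine transform of `g` on the half line. -/
noncomputable def sineTransform [NormedSpace ℝ E] (g : ℝ → E) (R : ℝ) : E :=
  ∫ r in Ioi 0, Real.sin (R * r) • g r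

theorem dist_sineTransform_le [NormedSpace ℝ E] {g h : ℝ → E} (hg : IntegrableOn g (Ioi 0))
    (hh : IntegrableOn h (Ioi 0)) (R : ℝ) :
    dist (sineTransform g R) (sineTransform h R) ≤ ∫ r in Ioi 0, dist (g r) (h r) := by
  simp only [dist_eq_norm]
  rw [sineTransform, sineTransform,
    ← integral_sub (integrable_sin_smul hg R) (integrable_sin_smul hh R)]
  refine norm_integral_le_of_norm_le (hg.sub hh).norm (.of_forall fun r => ?_)
  rw [← smul_sub, norm_smul]
  exact mul_le_of_le_one_left (norm_nonneg _) (Real.abs_sin_le_one _)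

theorem lipschitzWith_sineTransform [NormedSpace ℝ E] (R : ℝ) :
    LipschitzWith 1 fun f : Lp E 1 ((volume : Measure ℝ).restrict (Ioi 0)) =>
      sineTransform f R := by
  refine LipschitzWith.of_dist_le_mul fun f g => ?_
  rw [NNReal.coe_one, one_mul, L1.dist_eq_integral_dist]
  exact dist_sineTransform_le (L1.integrable_coeFn f) (L1.integrable_coeFn g) R

variable [NormedSpace ℂ E]

theorem tendsto_integral_exp_smul_atTop (g : ℝ → E) {c : ℝ} (hc : c ≠ 0) :
    Tendsto (fun R : ℝ => ∫ r, Complex.exp ((c * R * r : ℝ) * Complex.I) • g r) atTop (𝓝 0) := by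
  have hcocompact : Tendsto (fun R : ℝ => (-c / (2 * Real.pi)) * R) atTop (cocompact ℝ) :=
    (tendsto_cocompact_mul_left₀ (div_ne_zero (neg_ne_zero.2 hc) (by positivity))).comp
      atTop_le_cocompact
  refine ((Real.tendsto_integral_exp_smul_cocompact g).comp hcocompact).congr fun R => ?_
  refine integral_congr_ae (.of_forall fun r => ?_)
  simp only [Circle.smul_def, Real.fourierChar_apply]
  congr 4
  field_simp

theorem sineTransform_eq_integral_exp {g : ℝ → E} (hg : IntegrableOn g (Ioi 0)) (R : ℝ) :
    sineTransform g R = (2 * Complex.I)⁻¹ •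
      ((∫ r, Complex.exp ((1 * R * r : ℝ) * Complex.I) • (Ioi 0).indicator g r) -
        ∫ r, Complex.exp ((-1 * R * r : ℝ) * Complex.I) • (Ioi 0).indicator g r) := by
  have hint (c : ℝ) : Integrable fun r : ℝ =>
      Complex.exp ((c * R * r : ℝ) * Complex.I) • (Ioi 0).indicator g r :=
    (hg.integrable_indicator measurableSet_Ioi).bdd_smul 1 (by fun_prop)
      (.of_forall fun r => (Complex.norm_exp_ofReal_mul_I _).le)
  rw [sineTransform, ← integral_sub (hint 1) (hint (-1)), ← integral_smul,
    ← integral_indicator measurableSet_Ioi]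
  refine integral_congr_ae (.of_forall fun r => ?_)
  have hsin : (Real.sin (R * r) : ℂ) = (2 * Complex.I)⁻¹ *
      (Complex.exp ((1 * R * r : ℝ) * Complex.I) -
        Complex.exp ((-1 * R * r : ℝ) * Complex.I)) := by
    rw [Complex.exp_mul_I, Complex.exp_mul_I]
    push_cast
    rw [one_mul, neg_one_mul, neg_mul, Complex.cos_neg, Complex.sin_neg]
    field_simp
    ring
  simp only [indicator_smul_apply, ← Complex.coe_smul, hsin]
  rw [← sub_smul, smul_smul]

theorem tendsto_sineTransform_atTop {g : ℝ → E} (hg : IntegrableOn g (Ioi 0)) :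
    Tendsto (sineTransform g) atTop (𝓝 0) := by
  have hlim := ((tendsto_integral_exp_smul_atTop ((Ioi 0).indicator g) one_ne_zero).sub
    (tendsto_integral_exp_smul_atTop ((Ioi 0).indicator g)
      (neg_ne_zero.2 one_ne_zero))).const_smul ((2 * Complex.I)⁻¹ : ℂ)
  rw [sub_zero, smul_zero] at hlim
  exact hlim.congr fun R => (sineTransform_eq_integral_exp hg R).symm

theorem IsPrecompactInL1.tendstoUniformlyOn_sineTransform {S : Set (ℝ → E)}
    (hS : IsPrecompactInL1 S) :
    TendstoUniformlyOn (fun R g => sineTransform g R) 0 atTop S := by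
  have hclasses := tendstoUniformlyOn_of_uniformEquicontinuous
    (LipschitzWith.uniformEquicontinuous _ 1 lipschitzWith_sineTransform)
    (fun f => tendsto_sineTransform_atTop (L1.integrable_coeFn f)) hS.2
  intro U hU
  filter_upwards [hclasses U hU] with R hR g hg
  have hae := (hS.1 g hg).coeFn_toL1
  have hsine : sineTransform ((hS.1 g hg).toL1 g) R = sineTransform g R :=
    integral_congr_ae (hae.mono fun r hr => congrArg (Real.sin (R * r) • ·) hr)
  exact hsine ▸ hR _ ⟨g, hg, hae⟩

theorem IsPrecompactInL1.tendstoUniformlyOn_smul_sineTransform {α : Type*} {K : Set α}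
    {q : α → ℝ → E} (hq : IsPrecompactInL1 (q '' K)) (c : ℝ) :
    TendstoUniformlyOn (fun R x => c • sineTransform (q x) R) 0 atTop K := by
  have hlim := ((uniformContinuous_const_smul c).comp_tendstoUniformlyOn
    (hq.tendstoUniformlyOn_sineTransform.comp q)).mono (subset_preimage_image q K)
  exact hlim.congr_right fun x _ => smul_zero c

end SineTransform

section DirichletIntegral

theorem integral_exp_neg_mul_mul_sin (s T : ℝ) :
    ∫ r in 0..T, Real.exp (-r * s) * Real.sin r =
      (1 + s ^ 2)⁻¹ - Real.exp (-T * s) * ((Real.cos T + s * Real.sin T) / (1 + s ^ 2)) := by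
  have hs : 1 + s ^ 2 ≠ 0 := by positivity
  have hderiv : ∀ r ∈ uIcc 0 T, HasDerivAt (fun r =>
      -(Real.exp (-r * s) * ((Real.cos r + s * Real.sin r) / (1 + s ^ 2))))
      (Real.exp (-r * s) * Real.sin r) r := fun r _ => by
    have hexp : HasDerivAt (fun r => Real.exp (-r * s)) (Real.exp (-r * s) * (-1 * s)) r :=
      ((hasDerivAt_id r).neg.mul_const s).exp
    have htrig : HasDerivAt (fun r => Real.cos r + s * Real.sin r)
        (-Real.sin r + s * Real.cos r) r :=
      (Real.hasDerivAt_cos r).add ((Real.hasDerivAt_sin r).const_mul s)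
    convert! (hexp.mul (htrig.div_const (1 + s ^ 2))).neg using 1
    field_simp
    ring
  rw [intervalIntegral.integral_eq_sub_of_hasDerivAt hderiv
    (Continuous.intervalIntegrable (by fun_prop) _ _)]
  simp only [neg_zero, zero_mul, Real.exp_zero, Real.cos_zero, Real.sin_zero, mul_zero, add_zero]
  ring

theorem integral_Ioi_exp_neg_mul {r : ℝ} (hr : 0 < r) :
    ∫ s in Ioi (0 : ℝ), Real.exp (-r * s) = r⁻¹ := by
  rw [integral_exp_mul_Ioi (neg_lt_zero.2 hr)]
  simp [neg_div_neg_eq]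

theorem integrable_exp_neg_mul_mul_sin_prod (T : ℝ) :
    Integrable (fun p : ℝ × ℝ => Real.exp (-p.1 * p.2) * Real.sin p.1)
      ((volume.restrict (Ioc 0 T)).prod (volume.restrict (Ioi 0))) := by
  have hcont : Continuous fun p : ℝ × ℝ => Real.exp (-p.1 * p.2) * Real.sin p.1 := by fun_prop
  rw [integrable_prod_iff hcont.aestronglyMeasurable]
  constructor
  · filter_upwards [ae_restrict_mem measurableSet_Ioc] with r hr
    exact (integrableOn_exp_mul_Ioi (neg_lt_zero.2 hr.1) 0).mul_const _
  · have hinner : ∀ r ∈ Ioc 0 T,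
        ∫ s in Ioi 0, ‖Real.exp (-r * s) * Real.sin r‖ = |Real.sinc r| := fun r hr => by
      simp only [norm_mul, Real.norm_eq_abs, Real.abs_exp]
      rw [integral_mul_const, integral_Ioi_exp_neg_mul hr.1, Real.sinc_of_ne_zero hr.1.ne',
        abs_div, abs_of_pos hr.1, inv_mul_eq_div]
    exact (((Real.continuous_sinc.abs.integrableOn_Icc).mono_set Ioc_subset_Icc_self).congr_fun
      (fun r hr => (hinner r hr).symm) measurableSet_Ioc)

theorem abs_cos_add_mul_sin_div_le (s T : ℝ) :
    |(Real.cos T + s * Real.sin T) / (1 + s ^ 2)| ≤ 2 := by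
  rw [abs_div, abs_of_pos (by positivity : 0 < 1 + s ^ 2), div_le_iff₀ (by positivity)]
  calc |Real.cos T + s * Real.sin T| ≤ |Real.cos T| + |s| * |Real.sin T| := by
        rw [← abs_mul]; exact abs_add_le _ _
    _ ≤ 1 + |s| * 1 := by gcongr <;> simp only [Real.abs_cos_le_one, Real.abs_sin_le_one]
    _ ≤ 2 * (1 + s ^ 2) := by nlinarith [sq_nonneg (|s| - 1), sq_abs s]

theorem abs_integral_sinc_sub_pi_div_two_le {T : ℝ} (hT : 0 < T) :
    |(∫ r in 0..T, Real.sinc r) - Real.pi / 2| ≤ 2 / T := by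
  set ψ : ℝ → ℝ := fun s => Real.exp (-T * s) * ((Real.cos T + s * Real.sin T) / (1 + s ^ 2))
  have hexp := integrableOn_exp_mul_Ioi (neg_lt_zero.2 hT) 0
  have hψ : ∀ s, ‖ψ s‖ ≤ Real.exp (-T * s) * 2 := fun s => by
    rw [norm_mul, Real.norm_eq_abs, Real.abs_exp]
    gcongr
    exact abs_cos_add_mul_sin_div_le s T
  have hψint : IntegrableOn ψ (Ioi 0) :=
    (hexp.mul_const 2).mono' (by fun_prop (disch := positivity)) (.of_forall hψ)
  -- Insert `1 / r = ∫ s in Ioi 0, exp (-r * s)` and integrate in `r` first.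
  have hfubini : ∫ r in 0..T, Real.sinc r = Real.pi / 2 - ∫ s in Ioi 0, ψ s := by
    calc ∫ r in 0..T, Real.sinc r
        = ∫ r in Ioc 0 T, ∫ s in Ioi 0, Real.exp (-r * s) * Real.sin r := by
          rw [intervalIntegral.integral_of_le hT.le]
          refine setIntegral_congr_fun measurableSet_Ioc fun r hr => ?_
          rw [integral_mul_const, integral_Ioi_exp_neg_mul hr.1, Real.sinc_of_ne_zero hr.1.ne',
            inv_mul_eq_div]
      _ = ∫ s in Ioi 0, ∫ r in Ioc 0 T, Real.exp (-r * s) * Real.sin r :=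
          integral_integral_swap (integrable_exp_neg_mul_mul_sin_prod T)
      _ = ∫ s in Ioi 0, ((1 + s ^ 2)⁻¹ - ψ s) := by
          simp only [← intervalIntegral.integral_of_le hT.le, integral_exp_neg_mul_mul_sin, ψ]
      _ = Real.pi / 2 - ∫ s in Ioi 0, ψ s := by
          rw [integral_sub integrable_inv_one_add_sq.integrableOn hψint,
            integral_Ioi_inv_one_add_sq, Real.arctan_zero, sub_zero]
  rw [hfubini, sub_sub_cancel_left, abs_neg]
  refine (norm_integral_le_of_norm_le (hexp.mul_const 2) (.of_forall hψ)).trans_eq ?_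
  rw [integral_mul_const, integral_Ioi_exp_neg_mul hT, inv_mul_eq_div]

theorem tendsto_integral_sinc_atTop :
    Tendsto (fun T => ∫ r in 0..T, Real.sinc r) atTop (𝓝 (Real.pi / 2)) := by
  rw [tendsto_iff_norm_sub_tendsto_zero]
  refine squeeze_zero' (.of_forall fun _ => norm_nonneg _) ?_
    (tendsto_id.const_div_atTop (2 : ℝ))
  filter_upwards [eventually_gt_atTop 0] with T hT
  exact abs_integral_sinc_sub_pi_div_two_le hT

end DirichletIntegral

section BallKernel

/-- The integral `∫_{-R}^R (R² - t²)^p cos (t r) dt`. Up to a constant factor, it is the value at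
distance `r` from the origin of the Fourier transform of the indicator of the ball of radius `R`
in dimension `2 p + 1`. -/
noncomputable def ballKernel (R : ℝ) (p : ℕ) (r : ℝ) : ℝ :=
  ∫ t in -R..R, (R ^ 2 - t ^ 2) ^ p * Real.cos (t * r)

theorem mul_ballKernel_zero (R r : ℝ) : r * ballKernel R 0 r = 2 * Real.sin (R * r) := by
  simp only [ballKernel, pow_zero, one_mul]
  rw [intervalIntegral.mul_integral_comp_mul_right, integral_cos, neg_mul, Real.sin_neg,
    sub_neg_eq_add, two_mul]

theorem ballKernel_zero (R r : ℝ) : ballKernel R 0 r = 2 * R * Real.sinc (R * r) := by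
  rcases eq_or_ne r 0 with rfl | hr
  · simp [ballKernel, two_mul]
  rcases eq_or_ne R 0 with rfl | hR
  · simp [ballKernel]
  rw [Real.sinc_of_ne_zero (mul_ne_zero hR hr), ← mul_right_inj' hr, mul_ballKernel_zero]
  field_simp

theorem integral_mul_sq_sub_sq_pow_mul_sin (R : ℝ) (p : ℕ) (r : ℝ) :
    ∫ t in -R..R, t * (R ^ 2 - t ^ 2) ^ p * Real.sin (t * r) =
      r * ballKernel R (p + 1) r / (2 * (p + 1)) := by
  have hderiv : ∀ t ∈ uIcc (-R) R,
      HasDerivAt (fun t => (R ^ 2 - t ^ 2) ^ (p + 1) * Real.sin (t * r))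
      (r * ((R ^ 2 - t ^ 2) ^ (p + 1) * Real.cos (t * r)) -
        2 * (p + 1) * (t * (R ^ 2 - t ^ 2) ^ p * Real.sin (t * r))) t := fun t _ => by
    convert! (((hasDerivAt_id t).fun_pow 2).const_sub (R ^ 2)).fun_pow (p + 1) |>.mul
      ((hasDerivAt_id t).mul_const r).sin using 1
    simp only [id, Nat.add_sub_cancel]
    push_cast
    ring
  have hFTC := intervalIntegral.integral_eq_sub_of_hasDerivAt hderiv
    (Continuous.intervalIntegrable (by fun_prop) _ _)
  rw [intervalIntegral.integral_sub (Continuous.intervalIntegrable (by fun_prop) _ _)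
    (Continuous.intervalIntegrable (by fun_prop) _ _), intervalIntegral.integral_const_mul,
    intervalIntegral.integral_const_mul] at hFTC
  simp only [neg_sq, sub_self, zero_pow p.succ_ne_zero, zero_mul] at hFTC
  rw [eq_div_iff (by positivity), ballKernel]
  linarith

theorem hasDerivAt_ballKernel (R : ℝ) (p : ℕ) (r : ℝ) :
    HasDerivAt (ballKernel R p) (-(r * ballKernel R (p + 1) r / (2 * (p + 1)))) r := by
  rw [← integral_mul_sq_sub_sq_pow_mul_sin, ← intervalIntegral.integral_neg]
  refine (intervalIntegral.hasDerivAt_integral_of_dominated_loc_of_deriv_le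
    (F := fun r t => (R ^ 2 - t ^ 2) ^ p * Real.cos (t * r))
    (F' := fun r t => -(t * (R ^ 2 - t ^ 2) ^ p * Real.sin (t * r)))
    (bound := fun t => |t * (R ^ 2 - t ^ 2) ^ p|) univ_mem
    (.of_forall fun x => Continuous.aestronglyMeasurable (by fun_prop))
    (Continuous.intervalIntegrable (by fun_prop) _ _)
    (Continuous.aestronglyMeasurable (by fun_prop))
    (.of_forall fun t _ x _ => ?_)
    (Continuous.intervalIntegrable (by fun_prop) _ _)
    (.of_forall fun t _ x _ => ?_)).2
  · rw [norm_neg, norm_mul]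
    exact mul_le_of_le_one_right (norm_nonneg _) (Real.abs_sin_le_one _)
  · convert! ((hasDerivAt_id x).const_mul t).cos.const_mul ((R ^ 2 - t ^ 2) ^ p) using 1
    simp only [id]
    ring

theorem continuous_ballKernel (R : ℝ) (p : ℕ) : Continuous (ballKernel R p) :=
  continuous_iff_continuousAt.2 fun r => (hasDerivAt_ballKernel R p r).continuousAt

theorem sq_mul_ballKernel_one (R r : ℝ) :
    r ^ 2 * ballKernel R 1 r = 2 * (ballKernel R 0 r - 2 * R * Real.cos (R * r)) := by
  have hderiv : ∀ t ∈ uIcc (-R) R,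
      HasDerivAt (fun t => r * (R ^ 2 - t ^ 2) * Real.sin (t * r) - 2 * (t * Real.cos (t * r)))
      (r ^ 2 * ((R ^ 2 - t ^ 2) ^ 1 * Real.cos (t * r)) -
        2 * ((R ^ 2 - t ^ 2) ^ 0 * Real.cos (t * r))) t := fun t _ => by
    have htr := (hasDerivAt_id t).mul_const r
    convert! (((((hasDerivAt_id t).fun_pow 2).const_sub (R ^ 2)).const_mul r).mul htr.sin).sub
      (((hasDerivAt_id t).mul htr.cos).const_mul 2) using 1
    simp only [id]
    push_cast
    ring
  have hFTC := intervalIntegral.integral_eq_sub_of_hasDerivAt hderiv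
    (Continuous.intervalIntegrable (by fun_prop) _ _)
  rw [intervalIntegral.integral_sub (Continuous.intervalIntegrable (by fun_prop) _ _)
    (Continuous.intervalIntegrable (by fun_prop) _ _), intervalIntegral.integral_const_mul,
    intervalIntegral.integral_const_mul] at hFTC
  simp only [neg_sq, neg_mul, Real.cos_neg, sub_self] at hFTC
  simp only [ballKernel]
  linarith

theorem sq_mul_ballKernel_add_two (R : ℝ) (p : ℕ) (r : ℝ) :
    r ^ 2 * ballKernel R (p + 2) r =
      2 * (p + 2) * ((2 * p + 3) * ballKernel R (p + 1) r -
        2 * (p + 1) * R ^ 2 * ballKernel R p r) := by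
  have hderiv : ∀ t ∈ uIcc (-R) R,
      HasDerivAt (fun t => r * (R ^ 2 - t ^ 2) ^ (p + 2) * Real.sin (t * r) -
        2 * (p + 2) * (t * (R ^ 2 - t ^ 2) ^ (p + 1) * Real.cos (t * r)))
      (r ^ 2 * ((R ^ 2 - t ^ 2) ^ (p + 2) * Real.cos (t * r)) -
        2 * (p + 2) * ((2 * p + 3) * ((R ^ 2 - t ^ 2) ^ (p + 1) * Real.cos (t * r)) -
          2 * (p + 1) * R ^ 2 * ((R ^ 2 - t ^ 2) ^ p * Real.cos (t * r)))) t := fun t _ => by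
    have htr := (hasDerivAt_id t).mul_const r
    have hw := ((hasDerivAt_id t).fun_pow 2).const_sub (R ^ 2)
    convert! (((hw.fun_pow (p + 2)).const_mul r).mul htr.sin).sub
      ((((hasDerivAt_id t).mul (hw.fun_pow (p + 1))).mul htr.cos).const_mul
        (2 * (p + 2) : ℝ)) using 1
    simp only [id, Nat.add_sub_cancel, Pi.mul_apply, show p + 2 - 1 = p + 1 from rfl]
    push_cast
    ring
  have hFTC := intervalIntegral.integral_eq_sub_of_hasDerivAt hderiv
    (Continuous.intervalIntegrable (by fun_prop) _ _)
  rw [intervalIntegral.integral_sub (Continuous.intervalIntegrable (by fun_prop) _ _)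
    (Continuous.intervalIntegrable (by fun_prop) _ _), intervalIntegral.integral_const_mul,
    intervalIntegral.integral_const_mul,
    intervalIntegral.integral_sub (Continuous.intervalIntegrable (by fun_prop) _ _)
    (Continuous.intervalIntegrable (by fun_prop) _ _), intervalIntegral.integral_const_mul,
    intervalIntegral.integral_const_mul] at hFTC
  simp only [neg_sq, sub_self, zero_pow (Nat.succ_ne_zero _), mul_zero, zero_mul] at hFTC
  simp only [ballKernel]
  linarith

theorem isBigO_pow_mul_of_pow_succ_mul {f : ℝ → ℝ} {m : ℕ}
    (hf : (fun r => r ^ (m + 1) * f r) =O[atTop] (1 : ℝ → ℝ)) :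
    (fun r => r ^ m * f r) =O[atTop] (1 : ℝ → ℝ) := by
  refine IsBigO.trans (.of_bound 1 ?_) hf
  filter_upwards [eventually_ge_atTop 1] with r hr
  rw [one_mul, norm_mul, norm_mul, norm_pow, norm_pow]
  gcongr
  · exact hr.trans (le_abs_self r)
  · exact m.le_succ

-- `hasDerivAt_ballKernel` gives no decay; the recurrences, obtained by integrating by parts twice
-- in `t`, do.
theorem isBigO_pow_succ_mul_ballKernel (R : ℝ) :
    ∀ p, (fun r => r ^ (p + 1) * ballKernel R p r) =O[atTop] (1 : ℝ → ℝ)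
  | 0 => by
    refine .of_bound 2 (.of_forall fun r => ?_)
    rw [zero_add, pow_one, mul_ballKernel_zero, norm_mul, Real.norm_two, Pi.one_apply, norm_one]
    gcongr
    exact Real.abs_sin_le_one _
  | 1 => by
    have hcos : (fun r => Real.cos (R * r)) =O[atTop] (1 : ℝ → ℝ) :=
      .of_bound 1 (.of_forall fun r => by simpa using Real.abs_cos_le_one (R * r))
    have hzero := isBigO_pow_mul_of_pow_succ_mul (isBigO_pow_succ_mul_ballKernel R 0)
    simp only [pow_zero, one_mul] at hzero
    exact ((hzero.sub (hcos.const_mul_left (2 * R))).const_mul_left 2).congr_left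
      fun r => (sq_mul_ballKernel_one R r).symm
  | p + 2 => by
    have hsucc := isBigO_pow_mul_of_pow_succ_mul (isBigO_pow_succ_mul_ballKernel R (p + 1))
    refine (((hsucc.const_mul_left (2 * p + 3)).sub
      ((isBigO_pow_succ_mul_ballKernel R p).const_mul_left
        (2 * (p + 1) * R ^ 2))).const_mul_left (2 * (p + 2))).congr_left fun r => ?_
    rw [show r ^ (p + 2 + 1) * ballKernel R (p + 2) r =
      r ^ (p + 1) * (r ^ 2 * ballKernel R (p + 2) r) by ring, sq_mul_ballKernel_add_two]
    ring

end BallKernel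

section Slicing

/-- The measurable equivalence splitting off the first coordinate of a point of `ℝ^{m+1}`. -/
noncomputable def euclideanFinSuccEquiv (m : ℕ) :
    EuclideanSpace ℝ (Fin (m + 1)) ≃ᵐ ℝ × EuclideanSpace ℝ (Fin m) :=
  ((MeasurableEquiv.toLp 2 (Fin (m + 1) → ℝ)).symm.trans
    (MeasurableEquiv.piFinSuccAbove (fun _ => ℝ) 0)).trans
    ((MeasurableEquiv.refl ℝ).prodCongr (MeasurableEquiv.toLp 2 (Fin m → ℝ)))

theorem measurePreserving_euclideanFinSuccEquiv (m : ℕ) :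
    MeasurePreserving (euclideanFinSuccEquiv m) volume volume :=
  ((MeasurePreserving.id volume).prod (PiLp.volume_preserving_toLp (Fin m))).comp
    ((volume_preserving_piFinSuccAbove (fun _ => ℝ) 0).comp
      (PiLp.volume_preserving_ofLp (Fin (m + 1))))

theorem norm_sq_eq_euclideanFinSuccEquiv {m : ℕ} (ξ : EuclideanSpace ℝ (Fin (m + 1))) :
    ‖ξ‖ ^ 2 = (euclideanFinSuccEquiv m ξ).1 ^ 2 + ‖(euclideanFinSuccEquiv m ξ).2‖ ^ 2 := by
  rw [EuclideanSpace.norm_sq_eq, EuclideanSpace.norm_sq_eq, Fin.sum_univ_succ, Real.norm_eq_abs,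
    sq_abs]
  rfl

theorem mem_closedBall_zero_iff_euclideanFinSuccEquiv {m : ℕ} {R : ℝ} (hR : 0 ≤ R)
    (ξ : EuclideanSpace ℝ (Fin (m + 1))) :
    ξ ∈ Metric.closedBall 0 R ↔ (euclideanFinSuccEquiv m ξ).1 ∈ Icc (-R) R ∧
      (euclideanFinSuccEquiv m ξ).2 ∈
        Metric.closedBall 0 √(R ^ 2 - (euclideanFinSuccEquiv m ξ).1 ^ 2) := by
  rw [mem_closedBall_zero_iff, mem_closedBall_zero_iff, ← sq_le_sq₀ (norm_nonneg _) hR,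
    norm_sq_eq_euclideanFinSuccEquiv, mem_Icc, ← abs_le, ← abs_of_nonneg hR, ← sq_le_sq,
    abs_of_nonneg hR]
  constructor
  · intro h
    exact ⟨by nlinarith [sq_nonneg ‖(euclideanFinSuccEquiv m ξ).2‖],
      Real.le_sqrt_of_sq_le (by linarith)⟩
  · rintro ⟨h₁, h₂⟩
    linarith [(Real.le_sqrt (norm_nonneg _) (sub_nonneg.2 h₁)).1 h₂]

theorem integral_closedBall_comp_coord_zero {E : Type*} [NormedAddCommGroup E] [NormedSpace ℝ E]
    [CompleteSpace E] {m : ℕ} {R : ℝ} (hR : 0 ≤ R) {g : ℝ → E}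
    (hg : IntegrableOn (fun ξ : EuclideanSpace ℝ (Fin (m + 1)) => g (ξ 0))
      (Metric.closedBall 0 R)) :
    ∫ ξ in Metric.closedBall (0 : EuclideanSpace ℝ (Fin (m + 1))) R, g (ξ 0) =
      ∫ t in -R..R,
        volume.real (Metric.closedBall (0 : EuclideanSpace ℝ (Fin m)) √(R ^ 2 - t ^ 2)) • g t := by
  classical
  let G : ℝ × EuclideanSpace ℝ (Fin m) → E := fun p => (Icc (-R) R).indicator (fun t =>
    (Metric.closedBall 0 √(R ^ 2 - t ^ 2)).indicator (fun _ => g t) p.2) p.1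
  have hG : (Metric.closedBall 0 R).indicator (fun ξ => g (ξ 0)) =
      G ∘ euclideanFinSuccEquiv m := by
    ext ξ
    simp only [G, indicator_apply, mem_closedBall_zero_iff_euclideanFinSuccEquiv hR,
      Function.comp_apply, ← ite_and]
    rfl
  have hmp := measurePreserving_euclideanFinSuccEquiv m
  have hemb := (euclideanFinSuccEquiv m).measurableEmbedding
  have hGint : Integrable G := by
    rw [← hmp.integrable_comp_emb hemb, ← hG,
      integrable_indicator_iff Metric.isClosed_closedBall.measurableSet]
    exact hg
  have hinner : ∀ t, ∫ η, G (t, η) = (Icc (-R) R).indicator (fun t =>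
      volume.real (Metric.closedBall (0 : EuclideanSpace ℝ (Fin m)) √(R ^ 2 - t ^ 2)) • g t) t :=
    fun t => by
      by_cases ht : t ∈ Icc (-R) R
      · simp only [G, indicator_of_mem ht]
        rw [integral_indicator Metric.isClosed_closedBall.measurableSet, setIntegral_const]
      · simp only [G, indicator_of_notMem ht, integral_zero]
  calc ∫ ξ in Metric.closedBall (0 : EuclideanSpace ℝ (Fin (m + 1))) R, g (ξ 0)
      = ∫ ξ, G (euclideanFinSuccEquiv m ξ) := by
        rw [← integral_indicator Metric.isClosed_closedBall.measurableSet, hG]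
        rfl
    _ = ∫ t, ∫ η, G (t, η) := by
        rw [hmp.integral_comp hemb, Measure.volume_eq_prod, integral_prod _ hGint]
    _ = _ := by
        rw [intervalIntegral.integral_of_le (by linarith), ← integral_Icc_eq_integral_Ioc,
          ← integral_indicator measurableSet_Icc]
        simp only [hinner]

theorem volume_real_closedBall_even_dim (k : ℕ) {r : ℝ} (hr : 0 ≤ r) :
    volume.real (Metric.closedBall (0 : EuclideanSpace ℝ (Fin (2 * k))) r) =
      Real.pi ^ k / k.factorial * r ^ (2 * k) := by
  rcases k.eq_zero_or_pos with rfl | hk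
  · have hball : Metric.closedBall (0 : EuclideanSpace ℝ (Fin 0)) r = univ := by
      ext ξ
      simp [Subsingleton.elim ξ 0, hr]
    have hvol : volume (univ : Set (EuclideanSpace ℝ (Fin 0))) = 1 := by
      rw [← (PiLp.volume_preserving_toLp (Fin 0)).measure_preimage
        MeasurableSet.univ.nullMeasurableSet]
      simp [volume_pi]
    simp [Measure.real, hball, hvol]
  · have : NeZero k := ⟨hk.ne'⟩
    rw [Measure.real, InnerProductSpace.volume_closedBall_of_dim_even (k := k) (by simp),
      ENNReal.toReal_mul, ENNReal.toReal_pow, ENNReal.toReal_ofReal hr,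
      ENNReal.toReal_ofReal (by positivity), finrank_euclideanSpace_fin, mul_comm]

end Slicing

section DirichletKernel

/-- The `n`-dimensional spherical Dirichlet kernel `∫_{|ξ| ≤ R} e^{i y·ξ} dξ`, without the factor
`(2π)⁻ⁿ`. -/
noncomputable def dirichletKernel {n : ℕ} (R : ℝ) (y : EuclideanSpace ℝ (Fin n)) : ℂ :=
  ∫ ξ in Metric.closedBall (0 : EuclideanSpace ℝ (Fin n)) R,
    Complex.exp (Complex.I * ((inner ℝ y ξ : ℝ) : ℂ))

theorem dirichletKernel_eq_integral_coord_zero {m : ℕ} (R : ℝ)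
    (y : EuclideanSpace ℝ (Fin (m + 1))) :
    dirichletKernel R y = ∫ ξ in Metric.closedBall (0 : EuclideanSpace ℝ (Fin (m + 1))) R,
      Complex.exp (Complex.I * ((‖y‖ * ξ 0 : ℝ) : ℂ)) := by
  -- A reflection moves `y` to the first axis and preserves the ball.
  set z : EuclideanSpace ℝ (Fin (m + 1)) := ‖y‖ • EuclideanSpace.single 0 1
  set e := (Submodule.span ℝ {y - z})ᗮ.reflection
  have hey : e y = z := Submodule.reflection_sub (by simp [z, norm_smul])
  have hinner : ∀ ξ, inner ℝ y ξ = ‖y‖ * (e ξ) 0 := fun ξ => by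
    rw [← e.inner_map_map, hey, inner_smul_left, EuclideanSpace.inner_single_left]
    simp
  have hball : Metric.closedBall (0 : EuclideanSpace ℝ (Fin (m + 1))) R =
      e ⁻¹' Metric.closedBall 0 R := by
    rw [e.preimage_closedBall, map_zero]
  rw [dirichletKernel, hball]
  simp only [hinner]
  rw [e.measurePreserving.setIntegral_preimage_emb e.toHomeomorph.measurableEmbedding
    (fun ξ => Complex.exp (Complex.I * ((‖y‖ * ξ 0 : ℝ) : ℂ))), ← hball]

theorem integral_sq_sub_sq_pow_mul_exp (R : ℝ) (p : ℕ) (r : ℝ) :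
    ∫ t in -R..R, (((R ^ 2 - t ^ 2) ^ p : ℝ) : ℂ) * Complex.exp (Complex.I * ((r * t : ℝ) : ℂ)) =
      (ballKernel R p r : ℂ) := by
  have hsin : ∫ t in -R..R, (R ^ 2 - t ^ 2) ^ p * Real.sin (t * r) = 0 := by
    have hodd := intervalIntegral.integral_comp_neg (a := -R) (b := R)
      (fun t => (R ^ 2 - t ^ 2) ^ p * Real.sin (t * r))
    simp only [neg_neg, neg_sq, neg_mul, Real.sin_neg, mul_neg, intervalIntegral.integral_neg]
      at hodd
    linarith
  have heuler : ∀ t : ℝ, (((R ^ 2 - t ^ 2) ^ p : ℝ) : ℂ) * Complex.exp (Complex.I * (r * t : ℝ)) =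
      (((R ^ 2 - t ^ 2) ^ p * Real.cos (t * r) : ℝ) : ℂ) +
        Complex.I * (((R ^ 2 - t ^ 2) ^ p * Real.sin (t * r) : ℝ) : ℂ) := fun t => by
    rw [mul_comm Complex.I, Complex.exp_mul_I, ← Complex.ofReal_cos, ← Complex.ofReal_sin,
      mul_comm r t]
    push_cast
    ring
  simp only [heuler]
  rw [intervalIntegral.integral_add (Continuous.intervalIntegrable (by fun_prop) _ _)
    (Continuous.intervalIntegrable (by fun_prop) _ _), intervalIntegral.integral_const_mul,
    intervalIntegral.integral_ofReal, intervalIntegral.integral_ofReal, hsin, ballKernel,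
    Complex.ofReal_zero, mul_zero, add_zero]

theorem dirichletKernel_odd_dim {k : ℕ} {R : ℝ} (hR : 0 ≤ R)
    (y : EuclideanSpace ℝ (Fin (2 * k + 1))) :
    dirichletKernel R y = ((Real.pi ^ k / k.factorial * ballKernel R k ‖y‖ : ℝ) : ℂ) := by
  rw [dirichletKernel_eq_integral_coord_zero, integral_closedBall_comp_coord_zero hR
    (g := fun t => Complex.exp (Complex.I * ((‖y‖ * t : ℝ) : ℂ)))
    (ContinuousOn.integrableOn_compact (isCompact_closedBall _ _) (by fun_prop)),
    Complex.ofReal_mul, ← integral_sq_sub_sq_pow_mul_exp, ← intervalIntegral.integral_const_mul]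
  refine intervalIntegral.integral_congr fun t ht => ?_
  rw [uIcc_of_le (by linarith)] at ht
  have hw : 0 ≤ R ^ 2 - t ^ 2 := sub_nonneg.2 (sq_le_sq' ht.1 ht.2)
  simp only [volume_real_closedBall_even_dim k (Real.sqrt_nonneg _), pow_mul, Real.sq_sqrt hw,
    Complex.real_smul]
  push_cast
  ring

end DirichletKernel

section FourierPartial

variable {E : Type*} [NormedAddCommGroup E] [NormedSpace ℂ E] {n : ℕ}
  {F : EuclideanSpace ℝ (Fin n) → E}

theorem integrable_exp_inner_smul_prod (hF : Integrable F) (R : ℝ)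
    (x : EuclideanSpace ℝ (Fin n)) :
    Integrable (fun p : EuclideanSpace ℝ (Fin n) × EuclideanSpace ℝ (Fin n) =>
        Complex.exp (Complex.I * ((inner ℝ (x - p.2) p.1 : ℝ) : ℂ)) • F p.2)
      ((volume.restrict (Metric.closedBall 0 R)).prod volume) := by
  have : IsFiniteMeasure ((volume : Measure (EuclideanSpace ℝ (Fin n))).restrict
      (Metric.closedBall 0 R)) := isFiniteMeasure_restrict.2 measure_closedBall_lt_top.ne
  refine (hF.comp_snd _).bdd_smul 1 (by fun_prop) (.of_forall fun p => ?_)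
  rw [mul_comm, Complex.norm_exp_ofReal_mul_I]

variable [CompleteSpace E]

theorem integrable_dirichletKernel_smul (hF : Integrable F) (R : ℝ)
    (x : EuclideanSpace ℝ (Fin n)) :
    Integrable fun s => dirichletKernel R (x - s) • F s :=
  (integrable_exp_inner_smul_prod hF R x).integral_prod_right.congr
    (.of_forall fun s => integral_smul_const
      (fun ξ => Complex.exp (Complex.I * ((inner ℝ (x - s) ξ : ℝ) : ℂ))) (F s))

theorem fourierPartial_eq_integral_dirichletKernel_smul (hF : Integrable F) (R : ℝ)
    (x : EuclideanSpace ℝ (Fin n)) :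
    fourierPartial R F x =
      (((2 * Real.pi) ^ n)⁻¹ : ℝ) • ∫ s, dirichletKernel R (x - s) • F s := by
  have hphase : ∀ ξ s, Complex.exp (Complex.I * ((inner ℝ x ξ : ℝ) : ℂ)) •
      Complex.exp (-(Complex.I * ((inner ℝ ξ s : ℝ) : ℂ))) • F s =
        Complex.exp (Complex.I * ((inner ℝ (x - s) ξ : ℝ) : ℂ)) • F s := fun ξ s => by
    rw [smul_smul, ← Complex.exp_add, inner_sub_left, real_inner_comm ξ s, Complex.ofReal_sub,
      mul_sub, sub_eq_add_neg]
  rw [fourierPartial]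
  congr 1
  simp only [fourierHat, ← integral_smul, hphase, dirichletKernel, ← integral_smul_const]
  exact integral_integral_swap (integrable_exp_inner_smul_prod hF R x)

end FourierPartial

section PolarCoordinates

variable {V E : Type*} [NormedAddCommGroup V] [NormedSpace ℝ V] [FiniteDimensional ℝ V]
  [MeasurableSpace V] [BorelSpace V] [NormedAddCommGroup E] [NormedSpace ℝ E]

theorem integrable_volumeIoiPow_iff (m : ℕ) (g : ℝ → E) :
    Integrable (fun r : Ioi (0 : ℝ) => g r) (Measure.volumeIoiPow m) ↔
      IntegrableOn (fun r => r ^ m • g r) (Ioi 0) := by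
  rw [integrableOn_iff_comap_subtypeVal measurableSet_Ioi, Measure.volumeIoiPow,
    integrable_withDensity_iff_integrable_smul' (by fun_prop) (by simp)]
  refine integrable_congr (.of_forall fun r => ?_)
  simp only [Function.comp_apply]
  rw [ENNReal.toReal_ofReal (pow_nonneg (mem_Ioi.1 r.2).le m)]

theorem integral_volumeIoiPow (m : ℕ) (g : ℝ → E) :
    ∫ r : Ioi (0 : ℝ), g r ∂(Measure.volumeIoiPow m) = ∫ r in Ioi (0 : ℝ), r ^ m • g r := by
  simp only [Measure.volumeIoiPow, ENNReal.ofReal]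
  rw [integral_withDensity_eq_integral_smul (by fun_prop),
    integral_subtype_comap measurableSet_Ioi fun r => Real.toNNReal (r ^ m) • g r]
  refine setIntegral_congr_fun measurableSet_Ioi fun r (hr : 0 < r) => ?_
  simp only [NNReal.smul_def, Real.coe_toNNReal _ (pow_nonneg hr.le m)]

theorem integrableOn_and_integral_polar [Nontrivial V] (μ : Measure V) [μ.IsAddHaarMeasure]
    {G : V → E} (hG : Integrable G μ) :
    IntegrableOn (fun r : ℝ => r ^ (Module.finrank ℝ V - 1) •
        ∫ w, G (r • (w : V)) ∂μ.toSphere) (Ioi 0) ∧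
      ∫ y, G y ∂μ = ∫ r in Ioi (0 : ℝ), r ^ (Module.finrank ℝ V - 1) •
        ∫ w, G (r • (w : V)) ∂μ.toSphere := by
  have hmp := μ.measurePreserving_homeomorphUnitSphereProd
  have hemb := (homeomorphUnitSphereProd V).measurableEmbedding
  let H : Metric.sphere (0 : V) 1 × Ioi (0 : ℝ) → E := fun p => G ((p.2 : ℝ) • (p.1 : V))
  have hcomp : H ∘ homeomorphUnitSphereProd V = fun y : ({0}ᶜ : Set V) => G y := by
    ext y
    simp only [H, Function.comp_apply]
    rw [← homeomorphUnitSphereProd_symm_apply_coe, Homeomorph.symm_apply_apply]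
  have hH : Integrable H (μ.toSphere.prod (Measure.volumeIoiPow (Module.finrank ℝ V - 1))) := by
    rw [← hmp.integrable_comp_emb hemb, hcomp]
    exact (integrableOn_iff_comap_subtypeVal (measurableSet_singleton _).compl).1 hG.integrableOn
  refine ⟨(integrable_volumeIoiPow_iff _ fun r => ∫ w, G (r • (w : V)) ∂μ.toSphere).1
    hH.integral_prod_right, ?_⟩
  calc ∫ y, G y ∂μ = ∫ y : ({0}ᶜ : Set V), G y ∂(μ.comap (↑)) := by
        rw [integral_subtype_comap (measurableSet_singleton _).compl, restrict_compl_singleton]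
    _ = ∫ p, H p ∂μ.toSphere.prod (Measure.volumeIoiPow (Module.finrank ℝ V - 1)) := by
        rw [← hmp.integral_comp hemb]
        exact integral_congr_ae (.of_forall fun y => (congrFun hcomp y).symm)
    _ = _ := by
        rw [integral_prod_symm H hH,
          ← integral_volumeIoiPow _ fun r => ∫ w, G (r • (w : V)) ∂μ.toSphere]

end PolarCoordinates

section SphericalMean

variable {E : Type*} [NormedAddCommGroup E] [NormedSpace ℂ E] {n : ℕ} [NeZero n]
  {F : EuclideanSpace ℝ (Fin n) → E} {x : EuclideanSpace ℝ (Fin n)} {φ : ℝ → ℝ}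

theorem sphereMeasure_real_univ_pos : 0 < (sphereMeasure n).real univ := by
  rw [sphereMeasure, Measure.toSphere_real_apply_univ, finrank_euclideanSpace_fin]
  have hball : 0 < (volume : Measure (EuclideanSpace ℝ (Fin n))).real (Metric.ball 0 1) :=
    ENNReal.toReal_pos (Metric.measure_ball_pos _ _ one_pos).ne' measure_ball_lt_top.ne
  have hn : 0 < n := Nat.pos_of_neZero n
  positivity

theorem integral_sphere_eq_sphericalMean (r : ℝ) :
    ∫ w, F (x + r • (w : EuclideanSpace ℝ (Fin n))) ∂sphereMeasure n =
      (sphereMeasure n).real univ • sphericalMean F x r := by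
  rw [sphericalMean, smul_inv_smul₀ sphereMeasure_real_univ_pos.ne']

theorem integral_sphere_radial_smul {r : ℝ} (hr : 0 < r) :
    r ^ (Module.finrank ℝ (EuclideanSpace ℝ (Fin n)) - 1) •
      ∫ w, φ ‖r • (w : EuclideanSpace ℝ (Fin n))‖ •
        F (x + r • (w : EuclideanSpace ℝ (Fin n))) ∂sphereMeasure n =
    (sphereMeasure n).real univ • (r ^ (n - 1) * φ r) • sphericalMean F x r := by
  simp only [norm_smul, Real.norm_eq_abs, abs_of_pos hr, norm_eq_of_mem_sphere, mul_one]
  rw [integral_smul, integral_sphere_eq_sphericalMean, finrank_euclideanSpace_fin, smul_smul,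
    smul_comm]

theorem integrableOn_smul_sphericalMean (hφF : Integrable fun y => φ ‖y‖ • F (x + y)) :
    IntegrableOn (fun r => (r ^ (n - 1) * φ r) • sphericalMean F x r) (Ioi 0) := by
  refine IntegrableOn.congr_fun
    ((integrableOn_and_integral_polar volume hφF).1.smul ((sphereMeasure n).real univ)⁻¹)
    (fun r hr => ?_) measurableSet_Ioi
  exact (congrArg _ (integral_sphere_radial_smul hr)).trans
    (inv_smul_smul₀ sphereMeasure_real_univ_pos.ne' _)

theorem integral_radial_smul (hφF : Integrable fun y => φ ‖y‖ • F (x + y)) :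
    ∫ y, φ ‖y‖ • F (x + y) = (sphereMeasure n).real univ •
      ∫ r in Ioi 0, (r ^ (n - 1) * φ r) • sphericalMean F x r := by
  rw [(integrableOn_and_integral_polar volume hφF).2, ← integral_smul]
  exact setIntegral_congr_fun measurableSet_Ioi fun r hr => integral_sphere_radial_smul hr

end SphericalMean

section OddDimension

theorem sphereMeasure_real_univ_odd_dim (k : ℕ) :
    (sphereMeasure (2 * k + 1)).real univ * (2 * k).factorial =
      2 * Real.pi ^ k * 4 ^ k * k.factorial := by
  have hω : (sphereMeasure (2 * k + 1)).real univ * (2 * k + 1).doubleFactorial =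
      (2 * k + 1) * (Real.pi ^ k * 2 ^ (k + 1)) := by
    rw [sphereMeasure, Measure.toSphere_real_apply_univ, Measure.real,
      InnerProductSpace.volume_ball_of_dim_odd (k := k) (by simp), finrank_euclideanSpace_fin,
      ENNReal.ofReal_one, one_pow, one_mul, ENNReal.toReal_ofReal (by positivity)]
    have : ((2 * k + 1).doubleFactorial : ℝ) ≠ 0 :=
      Nat.cast_ne_zero.2 (Nat.doubleFactorial_pos _).ne'
    push_cast
    field_simp
  have hfactorial : ((2 * k + 1) * (2 * k).factorial : ℝ) =
      (2 * k + 1).doubleFactorial * (2 ^ k * k.factorial) := by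
    have := Nat.factorial_eq_mul_doubleFactorial (2 * k)
    rw [Nat.doubleFactorial_two_mul, Nat.factorial_succ] at this
    exact_mod_cast this
  refine mul_left_cancel₀ (by positivity : (2 * k + 1 : ℝ) ≠ 0) ?_
  calc (2 * k + 1 : ℝ) * ((sphereMeasure (2 * k + 1)).real univ * (2 * k).factorial)
      = (sphereMeasure (2 * k + 1)).real univ * ((2 * k + 1) * (2 * k).factorial) := by ring
    _ = (sphereMeasure (2 * k + 1)).real univ * (2 * k + 1).doubleFactorial *
          (2 ^ k * k.factorial) := by rw [hfactorial]; ring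
    _ = (2 * k + 1) * (2 * Real.pi ^ k * 4 ^ k * k.factorial) := by
      rw [hω, show (4 : ℝ) = 2 ^ 2 by norm_num, ← pow_mul]
      ring

theorem inversion_constant_odd_dim (k : ℕ) :
    ((2 * Real.pi) ^ (2 * k + 1))⁻¹ * (Real.pi ^ k / k.factorial) *
      (sphereMeasure (2 * k + 1)).real univ = (Real.pi * (2 * k).factorial)⁻¹ := by
  rw [eq_div_of_mul_eq (by positivity) (sphereMeasure_real_univ_odd_dim k),
    show (4 : ℝ) = 2 ^ 2 by norm_num, ← pow_mul]
  field_simp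
  ring

variable {E : Type*} [NormedAddCommGroup E] [NormedSpace ℂ E] {k : ℕ}
  {F : EuclideanSpace ℝ (Fin (2 * k + 1)) → E}

theorem dirichletKernel_smul_odd_dim {R : ℝ} (hR : 0 ≤ R)
    (x y : EuclideanSpace ℝ (Fin (2 * k + 1))) :
    dirichletKernel R (x - (x + y)) • F (x + y) =
      (Real.pi ^ k / k.factorial) • ballKernel R k ‖y‖ • F (x + y) := by
  rw [dirichletKernel_odd_dim hR, Complex.coe_smul, sub_add_cancel_left, norm_neg, mul_smul]

variable [CompleteSpace E]

theorem integrable_ballKernel_norm_smul (hF : Integrable F) {R : ℝ} (hR : 0 ≤ R)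
    (x : EuclideanSpace ℝ (Fin (2 * k + 1))) :
    Integrable fun y => ballKernel R k ‖y‖ • F (x + y) := by
  have hint := (integrable_dirichletKernel_smul hF R x).comp_add_left x
  simp only [dirichletKernel_smul_odd_dim hR] at hint
  exact (integrable_fun_smul_iff (by positivity : Real.pi ^ k / (k.factorial : ℝ) ≠ 0) _).1 hint

theorem integrableOn_ballKernel_smul_sphericalMean (hF : Integrable F) {R : ℝ} (hR : 0 ≤ R)
    (x : EuclideanSpace ℝ (Fin (2 * k + 1))) :
    IntegrableOn (fun r => (r ^ (2 * k) * ballKernel R k r) • sphericalMean F x r) (Ioi 0) := by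
  simpa only [Nat.add_sub_cancel] using
    integrableOn_smul_sphericalMean (integrable_ballKernel_norm_smul hF hR x)

theorem fourierPartial_odd_dim (hF : Integrable F) {R : ℝ} (hR : 0 ≤ R)
    (x : EuclideanSpace ℝ (Fin (2 * k + 1))) :
    fourierPartial R F x = (Real.pi * (2 * k).factorial : ℝ)⁻¹ •
      ∫ r in Ioi 0, (r ^ (2 * k) * ballKernel R k r) • sphericalMean F x r := by
  rw [fourierPartial_eq_integral_dirichletKernel_smul hF, ← integral_add_left_eq_self _ x]
  simp only [dirichletKernel_smul_odd_dim hR]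
  rw [integral_smul, integral_radial_smul (integrable_ballKernel_norm_smul hF hR x), smul_smul,
    smul_smul, inversion_constant_odd_dim, Nat.add_sub_cancel]

end OddDimension

section DiniQuotient

variable {E : Type*} [NormedAddCommGroup E]

/-- The quotient `(f r - 𝟙_{(0, δ)}(r) v) / r`. Its integrability on `(0, ∞)` is a Dini condition:
it expresses in the mean that `f r` tends to `v` as `r → 0`. -/
noncomputable def diniQuotient [NormedSpace ℝ E] (f : ℝ → E) (v : E) (δ r : ℝ) : E :=
  r⁻¹ • (f r - (Ioo 0 δ).indicator (fun _ => v) r)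

theorem setIntegral_pow_smul_eq_add_diniQuotient [NormedSpace ℝ E] [CompleteSpace E] {f : ℝ → E}
    {v : E} {δ : ℝ} (hδ : 0 ≤ δ) (hf : IntegrableOn (diniQuotient f v δ) (Ioi 0))
    (m : ℕ) :
    ∫ r in Ioo 0 δ, r ^ m • f r =
      (∫ r in Ioo 0 δ, r ^ (m + 1) • diniQuotient f v δ r) + (δ ^ (m + 1) / (m + 1)) • v := by
  have hpow : ∫ r in Ioo 0 δ, r ^ m = δ ^ (m + 1) / (m + 1) := by
    rw [← integral_Ioc_eq_integral_Ioo, ← intervalIntegral.integral_of_le hδ, integral_pow]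
    simp
  have hq : IntegrableOn (fun r => r ^ (m + 1) • diniQuotient f v δ r) (Ioo 0 δ) :=
    (hf.mono_set Ioo_subset_Ioi_self).continuousOn_smul_of_subset (K := Icc 0 δ)
      (by fun_prop) isCompact_Icc measurableSet_Ioo Ioo_subset_Icc_self
  have hc : IntegrableOn (fun r : ℝ => r ^ m • v) (Ioo 0 δ) :=
    (((continuous_pow m).integrableOn_Icc (a := 0) (b := δ)).mono_set
      Ioo_subset_Icc_self).smul_const v
  rw [← hpow, ← integral_smul_const, ← integral_add hq hc]
  refine setIntegral_congr_fun measurableSet_Ioo fun r hr => ?_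
  simp only [diniQuotient, indicator_of_mem hr, pow_succ, mul_smul, smul_inv_smul₀ hr.1.ne',
    smul_sub, sub_add_cancel]

theorem norm_setIntegral_pow_smul_le [NormedSpace ℝ E] {g : ℝ → E} {δ : ℝ} (hδ : 0 ≤ δ)
    (hg : IntegrableOn g (Ioi 0)) (m : ℕ) :
    ‖∫ r in Ioo 0 δ, r ^ m • g r‖ ≤ δ ^ m * ∫ r in Ioi 0, ‖g r‖ := by
  have hg' : IntegrableOn g (Ioo 0 δ) := hg.mono_set Ioo_subset_Ioi_self
  calc _ ≤ ∫ r in Ioo 0 δ, δ ^ m * ‖g r‖ := by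
        refine norm_integral_le_of_norm_le (hg'.norm.const_mul _) ?_
        filter_upwards [ae_restrict_mem measurableSet_Ioo] with r hr
        rw [norm_smul, Real.norm_of_nonneg (pow_nonneg hr.1.le m)]
        gcongr
        exacts [hr.1.le, hr.2.le]
    _ = δ ^ m * ∫ r in Ioo 0 δ, ‖g r‖ := integral_const_mul _ _
    _ ≤ δ ^ m * ∫ r in Ioi 0, ‖g r‖ := by
        gcongr
        · exact .of_forall fun _ => norm_nonneg _
        · exact hg.norm
        · exact Ioo_subset_Ioi_self

variable [NormedSpace ℂ E] {n : ℕ} [NeZero n] {F : EuclideanSpace ℝ (Fin n) → E}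

theorem norm_setIntegral_pow_smul_sphericalMean_le (hF : Integrable F)
    (x : EuclideanSpace ℝ (Fin n)) (δ : ℝ) :
    (sphereMeasure n).real univ * ‖∫ r in Ioo 0 δ, r ^ (n - 1) • sphericalMean F x r‖ ≤
      ∫ y, ‖F y‖ := by
  have hball : (fun y : EuclideanSpace ℝ (Fin n) =>
      (Iio δ).indicator (1 : ℝ → ℝ) ‖y‖ • F (x + y)) =
      (Metric.ball 0 δ).indicator fun y => F (x + y) := by
    ext y
    by_cases hy : ‖y‖ < δ
    · rw [indicator_of_mem (mem_ball_zero_iff.2 hy), indicator_of_mem (mem_Iio.2 hy), Pi.one_apply,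
        one_smul]
    · rw [indicator_of_notMem (mem_ball_zero_iff.not.2 hy), indicator_of_notMem (mem_Iio.not.2 hy),
        zero_smul]
  have hradial := integral_radial_smul (x := x) (φ := (Iio δ).indicator 1)
    (hball ▸ (hF.comp_add_left x).indicator measurableSet_ball)
  have hIoo : ∫ r in Ioi 0, (r ^ (n - 1) * (Iio δ).indicator 1 r) • sphericalMean F x r =
      ∫ r in Ioo 0 δ, r ^ (n - 1) • sphericalMean F x r := by
    rw [← Ioi_inter_Iio, ← setIntegral_indicator measurableSet_Iio]
    congr! 2 with r
    simp [indicator_apply]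
  rw [hIoo, hball] at hradial
  calc _ = ‖∫ y in Metric.ball 0 δ, F (x + y)‖ := by
        rw [← integral_indicator measurableSet_ball, hradial, norm_smul, Real.norm_of_nonneg
          measureReal_nonneg]
    _ ≤ ∫ y in Metric.ball 0 δ, ‖F (x + y)‖ := norm_integral_le_integral_norm _
    _ ≤ ∫ y, ‖F (x + y)‖ := setIntegral_le_integral (hF.comp_add_left x).norm
        (.of_forall fun _ => norm_nonneg _)
    _ = ∫ y, ‖F y‖ := integral_add_left_eq_self (fun y => ‖F y‖) x

-- The integral of `F` over the ball of radius `δ` about `x` is bounded by the `L¹` norm of `F`, and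
-- it differs from a fixed multiple of `F x` by a moment of the Dini quotient.
theorem exists_norm_le_of_isPrecompactInL1_diniQuotient [CompleteSpace E] (hF : Integrable F)
    {δ : ℝ} (hδ : 0 < δ) {K : Set (EuclideanSpace ℝ (Fin n))} (hK : IsPrecompactInL1
      ((fun x => diniQuotient (sphericalMean F x) (F x) δ) '' K)) :
    ∃ M, ∀ x ∈ K, ‖F x‖ ≤ M := by
  obtain ⟨C, hC⟩ := hK.exists_integral_norm_le
  have hn : 0 < n := Nat.pos_of_neZero n
  have hω := sphereMeasure_real_univ_pos (n := n)
  refine ⟨((∫ y, ‖F y‖) / (sphereMeasure n).real univ + δ ^ n * C) / (δ ^ n / n), fun x hx => ?_⟩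
  have hxK := mem_image_of_mem (fun x => diniQuotient (sphericalMean F x) (F x) δ) hx
  have hmean := setIntegral_pow_smul_eq_add_diniQuotient hδ.le (hK.1 _ hxK) (n - 1)
  have hquot : ‖∫ r in Ioo 0 δ, r ^ n • diniQuotient (sphericalMean F x) (F x) δ r‖ ≤
      δ ^ n * C := by
    refine (norm_setIntegral_pow_smul_le hδ.le (hK.1 _ hxK) n).trans ?_
    gcongr
    exact hC _ hxK
  rw [Nat.sub_add_cancel hn, ← Nat.cast_succ, Nat.succ_eq_add_one, Nat.sub_add_cancel hn] at hmean
  rw [le_div_iff₀' (by positivity)]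
  calc δ ^ n / n * ‖F x‖ = ‖(δ ^ n / n) • F x‖ := by
        rw [norm_smul, Real.norm_of_nonneg (by positivity)]
    _ ≤ _ := by
      rw [← sub_eq_iff_eq_add'.2 hmean]
      refine (norm_sub_le _ _).trans (add_le_add ?_ hquot)
      rw [le_div_iff₀' hω]
      exact norm_setIntegral_pow_smul_sphericalMean_le hF x δ

end DiniQuotient

section ParametricIntegral

variable {S E X : Type*} [TopologicalSpace S] [CompactSpace S] [SecondCountableTopology S]
  [MeasurableSpace S] [OpensMeasurableSpace S] [NormedAddCommGroup E] [NormedSpace ℝ E]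
  [NormedAddCommGroup X] [NormedSpace ℝ X]

theorem hasDerivAt_integral_of_contDiff (μ : Measure S) [IsFiniteMeasure μ] {v : S → E}
    (hv : Continuous v) {Ψ : ℝ × E → X} (hΨ : ContDiff ℝ 1 Ψ) (r : ℝ) :
    HasDerivAt (fun r => ∫ w, Ψ (r, v w) ∂μ) (∫ w, fderiv ℝ Ψ (r, v w) (1, 0) ∂μ) r := by
  have hc : Continuous Ψ := hΨ.continuous
  have hc' : Continuous fun p => fderiv ℝ Ψ p (1, 0) :=
    (hΨ.continuous_fderiv one_ne_zero).clm_apply continuous_const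
  have hcw : ∀ r, Continuous fun w => Ψ (r, v w) := fun r => by fun_prop
  have hcw' : ∀ r, Continuous fun w => fderiv ℝ Ψ (r, v w) (1, 0) := fun r =>
    hc'.comp (by fun_prop : Continuous fun w => (r, v w))
  obtain ⟨C, hC⟩ := ((isCompact_closedBall r 1).prod
    (isCompact_range hv)).exists_bound_of_continuousOn hc'.continuousOn
  refine (hasDerivAt_integral_of_dominated_loc_of_deriv_le (bound := fun _ => C)
    (F := fun r w => Ψ (r, v w)) (F' := fun r w => fderiv ℝ Ψ (r, v w) (1, 0))
    (Metric.ball_mem_nhds r one_pos)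
    (.of_forall fun r => (hcw r).aestronglyMeasurable) ?_
    (hcw' r).aestronglyMeasurable (.of_forall fun w s hs => ?_) (integrable_const _)
    (.of_forall fun w s _ => ?_)).2
  · obtain ⟨D, hD⟩ := isCompact_univ.exists_bound_of_continuousOn (hcw r).continuousOn
    exact Integrable.of_bound (hcw r).aestronglyMeasurable D
      (.of_forall fun w => hD w (mem_univ w))
  · exact hC _ ⟨Metric.ball_subset_closedBall hs, mem_range_self w⟩
  · have hΨd := (hΨ.differentiable one_ne_zero (s, v w)).hasFDerivAt
    exact hΨd.comp_hasDerivAt s ((hasDerivAt_id s).prodMk (hasDerivAt_const s (v w)))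

theorem contDiff_integral_of_contDiff (μ : Measure S) [IsFiniteMeasure μ] {v : S → E}
    (hv : Continuous v) {k : ℕ} {Ψ : ℝ × E → X} (hΨ : ContDiff ℝ k Ψ) :
    ContDiff ℝ k (fun r => ∫ w, Ψ (r, v w) ∂μ) := by
  induction k generalizing Ψ with
  | zero =>
    rw [Nat.cast_zero, contDiff_zero] at hΨ ⊢
    have : Continuous (Function.uncurry fun r w => Ψ (r, v w)) := by
      unfold Function.uncurry
      fun_prop
    simpa using continuous_parametric_integral_of_continuous (μ := μ) this isCompact_univ
  | succ k ih =>
    have hΨ1 : ContDiff ℝ 1 Ψ := hΨ.of_le (by exact_mod_cast Nat.le_add_left 1 k)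
    rw [Nat.cast_succ] at hΨ ⊢
    have hd := hasDerivAt_integral_of_contDiff μ hv hΨ1
    rw [contDiff_succ_iff_deriv]
    refine ⟨fun r => (hd r).differentiableAt, by simp, ?_⟩
    rw [funext fun r => (hd r).deriv]
    exact ih ((hΨ.fderiv_right le_rfl).clm_apply contDiff_const)

end ParametricIntegral

theorem contDiff_sphericalMean {X : Type*} [NormedAddCommGroup X] [NormedSpace ℂ X] {n k : ℕ}
    {F : EuclideanSpace ℝ (Fin n) → X} (hF : ContDiff ℝ k F) (x : EuclideanSpace ℝ (Fin n)) :
    ContDiff ℝ k (sphericalMean F x) := by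
  have : IsFiniteMeasure (sphereMeasure n) := inferInstanceAs (IsFiniteMeasure volume.toSphere)
  have hΨ : ContDiff ℝ k fun p : ℝ × EuclideanSpace ℝ (Fin n) => F (x + p.1 • p.2) :=
    hF.comp (by fun_prop)
  exact (contDiff_integral_of_contDiff (sphereMeasure n) continuous_subtype_val hΨ).const_smul _

section EulerOperator

open Polynomial

variable {E : Type*} [NormedAddCommGroup E] [NormedSpace ℝ E] {f : ℝ → E} {k : ℕ}

/-- The Euler operator `∑ aⱼ rʲ (d/dr)ʲ` with symbol `P = ∑ aⱼ Xʲ`, applied to `f` and evaluated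
at `r`. -/
noncomputable def eulerOperator (f : ℝ → E) (r : ℝ) : ℝ[X] →ₗ[ℝ] E :=
  Polynomial.lsum fun j => LinearMap.toSpanSingleton ℝ E (r ^ j • iteratedDeriv j f r)

theorem eulerOperator_monomial (f : ℝ → E) (r : ℝ) (j : ℕ) (a : ℝ) :
    eulerOperator f r (monomial j a) = a • r ^ j • iteratedDeriv j f r := by
  rw [eulerOperator, Polynomial.lsum_apply, sum_monomial_index a _ (LinearMap.map_zero _),
    LinearMap.toSpanSingleton_apply]

theorem eulerOperator_one (f : ℝ → E) (r : ℝ) : eulerOperator f r 1 = f r := by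
  rw [← monomial_zero_one, eulerOperator_monomial, one_smul, pow_zero, one_smul,
    iteratedDeriv_zero]

theorem eulerOperator_eq_sum_range (f : ℝ → E) (r : ℝ) {P : ℝ[X]} {m : ℕ}
    (hP : P.natDegree < m) :
    eulerOperator f r P = ∑ j ∈ Finset.range m, P.coeff j • r ^ j • iteratedDeriv j f r := by
  conv_lhs => rw [P.as_sum_range' m hP, map_sum]
  simp only [eulerOperator_monomial]

theorem X_mul_monomial_add_derivative {R : Type*} [CommSemiring R] (j : ℕ) (a : R) :
    X * (monomial j a + derivative (monomial j a)) = monomial (j + 1) a + monomial j (a * j) := by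
  rw [mul_add, X_mul_monomial, derivative_monomial, X_mul_monomial]
  cases j <;> simp

theorem hasDerivAt_iteratedDeriv (hf : ContDiff ℝ k f) {j : ℕ} (hj : j < k) (r : ℝ) :
    HasDerivAt (iteratedDeriv j f) (iteratedDeriv (j + 1) f r) r := by
  rw [iteratedDeriv_succ]
  exact (hf.differentiable_iteratedDeriv j (by exact_mod_cast hj) r).hasDerivAt

theorem contDiff_eulerOperator (hf : ContDiff ℝ k f) {P : ℝ[X]} {m : ℕ}
    (hP : P.natDegree + m ≤ k) : ContDiff ℝ m fun r => eulerOperator f r P := by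
  simp only [eulerOperator_eq_sum_range f _ P.natDegree.lt_succ_self]
  refine ContDiff.sum fun j hj => ?_
  rw [Finset.mem_range, Nat.lt_succ_iff] at hj
  have hfj : ContDiff ℝ m (iteratedDeriv j f) := by
    rw [iteratedDeriv_eq_iterate]
    exact (hf.of_le (by exact_mod_cast (by omega : m + j ≤ k))).iterate_deriv' m j
  fun_prop

theorem smul_deriv_eulerOperator (hf : ContDiff ℝ k f) {P : ℝ[X]} (hP : P.natDegree < k) (r : ℝ) :
    r • deriv (fun r => eulerOperator f r P) r = eulerOperator f r (X * (P + derivative P)) := by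
  have hderiv : HasDerivAt (fun r => eulerOperator f r P) (∑ j ∈ Finset.range k, P.coeff j •
      (r ^ j • iteratedDeriv (j + 1) f r + (j * r ^ (j - 1)) • iteratedDeriv j f r)) r := by
    simp only [eulerOperator_eq_sum_range f _ hP]
    exact HasDerivAt.fun_sum fun j hj => ((hasDerivAt_pow j r).smul
      (hasDerivAt_iteratedDeriv hf (Finset.mem_range.1 hj) r)).const_smul _
  rw [hderiv.deriv]
  conv_rhs => rw [P.as_sum_range' k hP, derivative_sum, ← Finset.sum_add_distrib, Finset.mul_sum]
  simp only [X_mul_monomial_add_derivative, map_sum, map_add, eulerOperator_monomial,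
    Finset.smul_sum]
  refine Finset.sum_congr rfl fun j _ => ?_
  rcases j with _ | j
  · simp only [Nat.cast_zero, zero_mul, mul_zero, zero_smul, zero_add, pow_one, pow_zero, add_zero,
      one_smul, smul_comm r]
  · simp only [Nat.add_sub_cancel, pow_succ]
    module

theorem pow_smul_tendsto_zero_of_le {g : ℝ → E} {m q : ℕ} (hqm : q ≤ m)
    (hg : Tendsto (fun r => r ^ m • g r) atTop (𝓝 0)) :
    Tendsto (fun r => r ^ q • g r) atTop (𝓝 0) := by
  refine squeeze_zero_norm' ?_ (tendsto_zero_iff_norm_tendsto_zero.1 hg)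
  filter_upwards [eventually_ge_atTop 1] with r hr
  simp only [norm_smul, norm_pow, Real.norm_of_nonneg (zero_le_one.trans hr)]
  gcongr

theorem tendsto_pow_smul_eulerOperator
    (hdecay : ∀ l < k, Tendsto (fun r => r ^ (k - 1) • iteratedDeriv l f r) atTop (𝓝 0))
    {P : ℝ[X]} {m : ℕ} (hP : P.natDegree + m < k) :
    Tendsto (fun r => r ^ m • eulerOperator f r P) atTop (𝓝 0) := by
  simp only [eulerOperator_eq_sum_range f _ P.natDegree.lt_succ_self, Finset.smul_sum]
  rw [← Finset.sum_const_zero (ι := ℕ) (s := Finset.range (P.natDegree + 1))]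
  refine tendsto_finsetSum _ fun j hj => ?_
  rw [Finset.mem_range] at hj
  have hterm := (pow_smul_tendsto_zero_of_le (q := m + j) (by omega)
    (hdecay j (by omega))).const_smul (P.coeff j)
  rw [smul_zero] at hterm
  refine hterm.congr fun r => ?_
  module

theorem tendsto_pow_smul_of_integrableOn [CompleteSpace E] {f' : ℝ → E} {m : ℕ}
    (hf : ∀ r, HasDerivAt f (f' r) r) (hfi : IntegrableOn (fun r => r ^ m • f r) (Ioi 0))
    (hfi' : IntegrableOn (fun r => r ^ m • f' r) (Ioi 0)) :
    Tendsto (fun r => r ^ m • f r) atTop (𝓝 0) := by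
  have hIoi : Ioi (1 : ℝ) ⊆ Ioi 0 := Ioi_subset_Ioi zero_le_one
  have hlower : IntegrableOn (fun r : ℝ => (m * r ^ (m - 1)) • f r) (Ioi 1) := by
    have hinv : IntegrableOn (fun r : ℝ => (m * r⁻¹) • r ^ m • f r) (Ioi 1) := by
      refine (hfi.mono_set hIoi).bdd_smul m (by fun_prop) ?_
      filter_upwards [ae_restrict_mem measurableSet_Ioi] with r (hr : 1 < r)
      rw [norm_mul, norm_inv, Real.norm_natCast, Real.norm_of_nonneg (by linarith)]
      exact mul_le_of_le_one_right m.cast_nonneg (inv_le_one_of_one_le₀ hr.le)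
    refine IntegrableOn.congr_fun hinv (fun r (hr : 1 < r) => ?_) measurableSet_Ioi
    rcases m with _ | m
    · simp
    · rw [smul_smul, pow_succ, Nat.add_sub_cancel]
      congr 1
      field_simp
  exact tendsto_zero_of_hasDerivAt_of_integrableOn_Ioi
    (fun r _ => (hasDerivAt_pow m r).smul (hf r)) ((hfi'.mono_set hIoi).add hlower)
    (hfi.mono_set hIoi)

/-- Integration by parts turns the integral of `r ^ (2 p) * ballKernel R p r` against the Euler
operator of symbol `P` into that of `ballKernel R 0 r` against the one of symbol
`lowerSymbol p P`. -/
noncomputable def lowerSymbol : ℕ → ℝ[X] → ℝ[X]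
  | 0, P => P
  | p + 1, P => lowerSymbol p
      ((2 * (p + 1) : ℝ) • ((2 * p + 1 : ℝ) • P + X * (P + derivative P)))

theorem natDegree_symbol_step_le (a b : ℝ) (P : ℝ[X]) :
    (a • (b • P + X * (P + derivative P))).natDegree ≤ P.natDegree + 1 := by
  have hadd : (P + derivative P).natDegree ≤ P.natDegree :=
    natDegree_add_le_of_degree_le le_rfl ((natDegree_derivative_le P).trans (Nat.sub_le _ _))
  have hX : (X * (P + derivative P)).natDegree ≤ P.natDegree + 1 :=
    (natDegree_mul_le_of_le natDegree_X_le hadd).trans_eq (add_comm _ _)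
  exact (natDegree_smul_le _ _).trans (natDegree_add_le_of_degree_le
    ((natDegree_smul_le _ _).trans (Nat.le_succ _)) hX)

theorem natDegree_lowerSymbol_le (p : ℕ) (P : ℝ[X]) :
    (lowerSymbol p P).natDegree ≤ P.natDegree + p := by
  induction p generalizing P with
  | zero => rfl
  | succ p ih =>
    rw [lowerSymbol]
    refine (ih _).trans ?_
    have := natDegree_symbol_step_le (2 * (p + 1)) (2 * p + 1) P
    omega

theorem coeff_zero_lowerSymbol (p : ℕ) (P : ℝ[X]) :
    (lowerSymbol p P).coeff 0 = (2 * p).factorial * P.coeff 0 := by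
  induction p generalizing P with
  | zero => simp [lowerSymbol]
  | succ p ih =>
    rw [lowerSymbol, ih, coeff_smul, coeff_add, coeff_smul, mul_coeff_zero, coeff_X_zero,
      smul_eq_mul, smul_eq_mul, show 2 * (p + 1) = 2 * p + 1 + 1 by ring, Nat.factorial_succ,
      Nat.factorial_succ]
    push_cast
    ring

end EulerOperator

section ByParts

open Polynomial

variable {E : Type*} [NormedAddCommGroup E] [NormedSpace ℝ E] {f : ℝ → E} {k : ℕ}

theorem tendsto_ballKernel_smul_eulerOperator_atTop (R : ℝ) (p : ℕ)
    (hdecay : ∀ l < k, Tendsto (fun r => r ^ (k - 1) • iteratedDeriv l f r) atTop (𝓝 0))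
    {P : ℝ[X]} (hP : P.natDegree + p < k) :
    Tendsto (fun r => (r ^ (2 * p + 1) * ballKernel R p r) • eulerOperator f r P)
      atTop (𝓝 0) := by
  have ho := (isBigO_pow_succ_mul_ballKernel R p).smul_isLittleO
    ((isLittleO_one_iff ℝ).2 (tendsto_pow_smul_eulerOperator hdecay hP))
  refine ((isLittleO_one_iff ℝ).1 (ho.congr_right fun _ => one_smul ℝ _)).congr fun r => ?_
  module

variable [CompleteSpace E]

theorem integral_ballKernel_succ_smul (R : ℝ) (p : ℕ) {g : ℝ → E} (hg : ContDiff ℝ 1 g) (N : ℝ) :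
    ∫ r in 0..N, (r ^ (2 * (p + 1)) * ballKernel R (p + 1) r) • g r =
      (∫ r in 0..N, (r ^ (2 * p) * ballKernel R p r) •
        (2 * (p + 1) : ℝ) • ((2 * p + 1 : ℝ) • g r + r • deriv g r)) -
      (2 * (p + 1) * (N ^ (2 * p + 1) * ballKernel R p N)) • g N := by
  have hA := continuous_ballKernel R p
  have hA' := continuous_ballKernel R (p + 1)
  have hgc := hg.continuous
  have := hg.continuous_deriv_one
  have hderiv : ∀ r ∈ uIcc 0 N, HasDerivAt
      (fun r => (2 * (p + 1) * (r ^ (2 * p + 1) * ballKernel R p r)) • g r)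
      ((r ^ (2 * p) * ballKernel R p r) •
        (2 * (p + 1) : ℝ) • ((2 * p + 1 : ℝ) • g r + r • deriv g r) -
        (r ^ (2 * (p + 1)) * ballKernel R (p + 1) r) • g r) r := fun r _ => by
    convert! (((hasDerivAt_pow (2 * p + 1) r).mul
      (hasDerivAt_ballKernel R p r)).const_mul (2 * (p + 1) : ℝ)).smul
        (hg.differentiable one_ne_zero r).hasDerivAt using 1
    have hp : (p + 1 : ℝ) ≠ 0 := by positivity
    simp only [Nat.add_sub_cancel, Pi.mul_apply]
    match_scalars <;> field_simp <;> ring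
  have hFTC := intervalIntegral.integral_eq_sub_of_hasDerivAt hderiv
    (Continuous.intervalIntegrable (by fun_prop) _ _)
  rw [intervalIntegral.integral_sub (Continuous.intervalIntegrable (by fun_prop) _ _)
    (Continuous.intervalIntegrable (by fun_prop) _ _)] at hFTC
  simp only [zero_pow (Nat.succ_ne_zero _), zero_mul, mul_zero, zero_smul, sub_zero] at hFTC
  rw [← hFTC]
  abel

theorem integral_ballKernel_succ_smul_eulerOperator (R : ℝ) (p : ℕ) (hf : ContDiff ℝ k f)
    {P : ℝ[X]} (hP : P.natDegree < k) (N : ℝ) :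
    ∫ r in 0..N, (r ^ (2 * (p + 1)) * ballKernel R (p + 1) r) • eulerOperator f r P =
      (∫ r in 0..N, (r ^ (2 * p) * ballKernel R p r) • eulerOperator f r
        ((2 * (p + 1) : ℝ) • ((2 * p + 1 : ℝ) • P + X * (P + derivative P)))) -
      (2 * (p + 1) * (N ^ (2 * p + 1) * ballKernel R p N)) • eulerOperator f N P := by
  rw [integral_ballKernel_succ_smul R p (contDiff_eulerOperator hf (m := 1) hP)]
  simp only [smul_deriv_eulerOperator hf hP, map_smul, map_add]

theorem tendsto_integral_ballKernel_smul_eulerOperator_sub (R : ℝ) (hf : ContDiff ℝ k f)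
    (hdecay : ∀ l < k, Tendsto (fun r => r ^ (k - 1) • iteratedDeriv l f r) atTop (𝓝 0))
    (p : ℕ) {P : ℝ[X]} (hP : P.natDegree + p ≤ k) :
    Tendsto (fun N => (∫ r in 0..N, (r ^ (2 * p) * ballKernel R p r) • eulerOperator f r P) -
      ∫ r in 0..N, ballKernel R 0 r • eulerOperator f r (lowerSymbol p P)) atTop (𝓝 0) := by
  induction p generalizing P with
  | zero => simp [lowerSymbol]
  | succ p ih =>
    have hP' := natDegree_symbol_step_le (2 * (p + 1)) (2 * p + 1) P
    have hboundary := (tendsto_ballKernel_smul_eulerOperator_atTop R p hdecay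
      (by omega : P.natDegree + p < k)).const_smul (2 * (p + 1) : ℝ)
    have hlim := (ih ((Nat.add_le_add_right hP' p).trans (by omega))).sub hboundary
    rw [smul_zero, sub_zero] at hlim
    refine hlim.congr fun N => ?_
    rw [integral_ballKernel_succ_smul_eulerOperator R p hf (by omega), lowerSymbol, smul_smul]
    abel

theorem integral_Ioi_ballKernel_smul (R : ℝ) (hf : ContDiff ℝ k f)
    (hdecay : ∀ l < k, Tendsto (fun r => r ^ (k - 1) • iteratedDeriv l f r) atTop (𝓝 0))
    (hint : IntegrableOn (fun r => (r ^ (2 * k) * ballKernel R k r) • f r) (Ioi 0))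
    (hint' : IntegrableOn (fun r => ballKernel R 0 r • eulerOperator f r (lowerSymbol k 1))
      (Ioi 0)) :
    ∫ r in Ioi 0, (r ^ (2 * k) * ballKernel R k r) • f r =
      ∫ r in Ioi 0, ballKernel R 0 r • eulerOperator f r (lowerSymbol k 1) := by
  have hlim := tendsto_integral_ballKernel_smul_eulerOperator_sub R hf hdecay k (P := 1) (by simp)
  simp only [eulerOperator_one] at hlim
  exact sub_eq_zero.1 (tendsto_nhds_unique
    ((intervalIntegral_tendsto_integral_Ioi 0 hint tendsto_id).sub
      (intervalIntegral_tendsto_integral_Ioi 0 hint' tendsto_id)) hlim)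

end ByParts

section Representation

open Polynomial

variable {E : Type*} [NormedAddCommGroup E] [NormedSpace ℝ E] {f : ℝ → E} {v : E} {δ : ℝ}

theorem ballKernel_zero_smul_eq_diniQuotient (f : ℝ → E) (v : E) (δ R : ℝ) {r : ℝ} (hr : 0 < r) :
    ballKernel R 0 r • f r = (2 : ℝ) • Real.sin (R * r) • diniQuotient f v δ r +
      (Ioo 0 δ).indicator (fun r => (2 * (R * Real.sinc (R * r))) • v) r := by
  have hf : f r = r • diniQuotient f v δ r + (Ioo 0 δ).indicator (fun _ => v) r := by
    rw [diniQuotient, smul_inv_smul₀ hr.ne', sub_add_cancel]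
  rw [hf, smul_add, smul_smul, mul_comm, mul_ballKernel_zero, mul_smul, ballKernel_zero, mul_assoc]
  congr 1
  exact (indicator_smul_apply _ (fun r => 2 * (R * Real.sinc (R * r))) (fun _ => v) r).symm

theorem integrableOn_indicator_sinc_smul (v : E) (δ R : ℝ) :
    IntegrableOn ((Ioo 0 δ).indicator fun r => (2 * (R * Real.sinc (R * r))) • v) (Ioi 0) := by
  have hcont : Continuous fun r => (2 * (R * Real.sinc (R * r))) • v := by fun_prop
  exact ((hcont.integrableOn_Icc.mono_set Ioo_subset_Icc_self).integrable_indicator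
    measurableSet_Ioo).integrableOn

theorem integral_indicator_sinc_smul [CompleteSpace E] (v : E) (hδ : 0 ≤ δ) (R : ℝ) :
    ∫ r in Ioi 0, (Ioo 0 δ).indicator (fun r => (2 * (R * Real.sinc (R * r))) • v) r =
      (2 * ∫ r in 0..R * δ, Real.sinc r) • v := by
  rw [setIntegral_indicator measurableSet_Ioo, inter_eq_right.2 Ioo_subset_Ioi_self,
    ← integral_Ioc_eq_integral_Ioo, ← intervalIntegral.integral_of_le hδ,
    intervalIntegral.integral_smul_const, intervalIntegral.integral_const_mul,
    intervalIntegral.integral_const_mul, intervalIntegral.mul_integral_comp_mul_left, mul_zero]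

theorem integrableOn_ballKernel_zero_smul (hf : IntegrableOn (diniQuotient f v δ) (Ioi 0))
    (R : ℝ) : IntegrableOn (fun r => ballKernel R 0 r • f r) (Ioi 0) :=
  IntegrableOn.congr_fun
    (((integrable_sin_smul hf R).smul (2 : ℝ)).add (integrableOn_indicator_sinc_smul v δ R))
    (fun _ hr => (ballKernel_zero_smul_eq_diniQuotient f v δ R hr).symm) measurableSet_Ioi

theorem integral_ballKernel_zero_smul [CompleteSpace E] (hδ : 0 ≤ δ)
    (hf : IntegrableOn (diniQuotient f v δ) (Ioi 0)) (R : ℝ) :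
    ∫ r in Ioi 0, ballKernel R 0 r • f r =
      (2 : ℝ) • sineTransform (diniQuotient f v δ) R + (2 * ∫ r in 0..R * δ, Real.sinc r) • v := by
  have hsin : IntegrableOn (fun r => (2 : ℝ) • Real.sin (R * r) • diniQuotient f v δ r) (Ioi 0) :=
    (integrable_sin_smul hf R).smul _
  rw [setIntegral_congr_fun measurableSet_Ioi
      fun r hr => ballKernel_zero_smul_eq_diniQuotient f v δ R hr,
    integral_add hsin (integrableOn_indicator_sinc_smul v δ R),
    integral_smul, integral_indicator_sinc_smul v hδ, sineTransform]

theorem ballKernel_zero_smul_eulerOperator (f : ℝ → E) (R r : ℝ) {Q : ℝ[X]} {k : ℕ}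
    (hQ : Q.natDegree ≤ k) :
    ballKernel R 0 r • eulerOperator f r Q = Q.coeff 0 • ballKernel R 0 r • f r +
      ∑ j ∈ Finset.range k, (2 * Q.coeff (j + 1)) •
        Real.sin (R * r) • r ^ j • iteratedDeriv (j + 1) f r := by
  rw [eulerOperator_eq_sum_range f r (Nat.lt_succ_of_le hQ), Finset.sum_range_succ', smul_add,
    Finset.smul_sum, add_comm, pow_zero, one_smul, iteratedDeriv_zero, smul_comm]
  congr 1
  refine Finset.sum_congr rfl fun j _ => ?_
  simp only [smul_smul]
  congr 1
  linear_combination Q.coeff (j + 1) * r ^ j * mul_ballKernel_zero R r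

section

variable {k : ℕ} {Q : ℝ[X]} (hf : IntegrableOn (diniQuotient f v δ) (Ioi 0))
  (hder : ∀ j < k, IntegrableOn (fun r => r ^ j • iteratedDeriv (j + 1) f r) (Ioi 0))
  (hQ : Q.natDegree ≤ k)
include hf hder hQ

theorem integrableOn_ballKernel_zero_smul_eulerOperator (R : ℝ) :
    IntegrableOn (fun r => ballKernel R 0 r • eulerOperator f r Q) (Ioi 0) := by
  simp only [ballKernel_zero_smul_eulerOperator f R _ hQ]
  exact ((integrableOn_ballKernel_zero_smul hf R).smul _).add (integrable_finsetSum _ fun j hj =>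
    (integrable_sin_smul (hder j (Finset.mem_range.1 hj)) R).smul _)

theorem integral_ballKernel_zero_smul_eulerOperator [CompleteSpace E] (hδ : 0 ≤ δ) (R : ℝ) :
    ∫ r in Ioi 0, ballKernel R 0 r • eulerOperator f r Q =
      Q.coeff 0 • ((2 : ℝ) • sineTransform (diniQuotient f v δ) R +
        (2 * ∫ r in 0..R * δ, Real.sinc r) • v) +
      ∑ j ∈ Finset.range k, (2 * Q.coeff (j + 1)) •
        sineTransform (fun r => r ^ j • iteratedDeriv (j + 1) f r) R := by
  have hterm : ∀ j ∈ Finset.range k, IntegrableOn (fun r => (2 * Q.coeff (j + 1)) •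
      Real.sin (R * r) • r ^ j • iteratedDeriv (j + 1) f r) (Ioi 0) := fun j hj =>
    (integrable_sin_smul (hder j (Finset.mem_range.1 hj)) R).smul _
  have hzero : IntegrableOn (fun r => Q.coeff 0 • ballKernel R 0 r • f r) (Ioi 0) :=
    (integrableOn_ballKernel_zero_smul hf R).smul _
  simp only [ballKernel_zero_smul_eulerOperator f R _ hQ]
  rw [integral_add hzero (integrable_finsetSum _ hterm), integral_smul,
    integral_ballKernel_zero_smul hδ hf, integral_finsetSum _ hterm]
  simp only [integral_smul, sineTransform]

end

theorem tendsto_pow_smul_iteratedDeriv [CompleteSpace E] {k : ℕ} (hf : ContDiff ℝ k f)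
    (hlower : ∀ l < k, IntegrableOn (fun r => r ^ (k - 1) • iteratedDeriv l f r) (Ioi 0))
    (htop : IntegrableOn (fun r => r ^ (k - 1) • iteratedDeriv k f r) (Ioi 0)) {l : ℕ}
    (hl : l < k) : Tendsto (fun r => r ^ (k - 1) • iteratedDeriv l f r) atTop (𝓝 0) := by
  refine tendsto_pow_smul_of_integrableOn (hasDerivAt_iteratedDeriv hf hl) (hlower l hl) ?_
  obtain hlk | rfl := (Nat.succ_le_of_lt hl).lt_or_eq
  exacts [hlower _ hlk, htop]

end Representation

section Main

variable {E : Type*} [NormedAddCommGroup E] [NormedSpace ℂ E] [CompleteSpace E] {k : ℕ}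
  {F : EuclideanSpace ℝ (Fin (2 * k + 1)) → E}

theorem fourierPartial_eq_sineTransform (hF_int : Integrable F) (hF_diff : ContDiff ℝ k F)
    {δ : ℝ} (hδ : 0 ≤ δ) {x : EuclideanSpace ℝ (Fin (2 * k + 1))}
    (hdini : IntegrableOn (diniQuotient (sphericalMean F x) (F x) δ) (Ioi 0))
    (hder : ∀ j < k, IntegrableOn
      (fun r => r ^ j • iteratedDeriv (j + 1) (sphericalMean F x) r) (Ioi 0))
    (hdecay : ∀ l < k, Tendsto (fun r => r ^ (k - 1) • iteratedDeriv l (sphericalMean F x) r)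
      atTop (𝓝 0))
    {R : ℝ} (hR : 0 ≤ R) :
    fourierPartial R F x =
      (2 / Real.pi) • sineTransform (diniQuotient (sphericalMean F x) (F x) δ) R +
      (2 / Real.pi * ∫ r in 0..R * δ, Real.sinc r) • F x +
      ∑ j ∈ Finset.range k,
        (2 * (lowerSymbol k 1).coeff (j + 1) / (Real.pi * (2 * k).factorial)) •
          sineTransform (fun r => r ^ j • iteratedDeriv (j + 1) (sphericalMean F x) r) R := by
  have hQ : (lowerSymbol k 1).natDegree ≤ k := by
    simpa using natDegree_lowerSymbol_le k 1
  have hQ0 : (lowerSymbol k 1).coeff 0 = (2 * k).factorial := by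
    simp [coeff_zero_lowerSymbol]
  rw [fourierPartial_odd_dim hF_int hR, integral_Ioi_ballKernel_smul R
    (contDiff_sphericalMean hF_diff x) hdecay
    (integrableOn_ballKernel_smul_sphericalMean hF_int hR x)
    (integrableOn_ballKernel_zero_smul_eulerOperator hdini hder hQ R),
    integral_ballKernel_zero_smul_eulerOperator hdini hder hQ hδ, hQ0, smul_add, Finset.smul_sum]
  congr 1
  · match_scalars <;> field_simp
  · refine Finset.sum_congr rfl fun j _ => ?_
    rw [smul_smul]
    congr 1
    field_simp

theorem mainTheorem6_general {δ : ℝ} (hδ : 0 < δ) {K : Set (EuclideanSpace ℝ (Fin (2 * k + 1)))}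
    (hF_int : Integrable F) (hF_diff : ContDiff ℝ k F)
    (hdini : IsPrecompactInL1 ((fun x => diniQuotient (sphericalMean F x) (F x) δ) '' K))
    (hder : ∀ j < k, IsPrecompactInL1
      ((fun x r => r ^ j • iteratedDeriv (j + 1) (sphericalMean F x) r) '' K))
    (hlower : ∀ x ∈ K, ∀ l < k,
      IntegrableOn (fun r => r ^ (k - 1) • iteratedDeriv l (sphericalMean F x) r) (Ioi 0)) :
    FourierInversionUniformlyOn F K := by
  obtain ⟨M, hM⟩ := exists_norm_le_of_isPrecompactInL1_diniQuotient hF_int hδ hdini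
  have hdecay : ∀ x ∈ K, ∀ l < k,
      Tendsto (fun r => r ^ (k - 1) • iteratedDeriv l (sphericalMean F x) r) atTop (𝓝 0) := by
    intro x hx l hl
    have htop := (hder (k - 1) (by omega)).1 _ (mem_image_of_mem _ hx)
    rw [Nat.sub_add_cancel (Nat.one_le_of_lt hl)] at htop
    exact tendsto_pow_smul_iteratedDeriv (contDiff_sphericalMean hF_diff x) (hlower x hx) htop hl
  have hsinc : Tendsto (fun R => 2 / Real.pi * ∫ r in 0..R * δ, Real.sinc r) atTop (𝓝 1) := by
    have hlim := (tendsto_integral_sinc_atTop.comp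
      (tendsto_id.atTop_mul_const hδ)).const_mul (2 / Real.pi)
    rwa [div_mul_div_cancel₀ Real.pi_ne_zero, div_self two_ne_zero] at hlim
  have hlim := ((hdini.tendstoUniformlyOn_smul_sineTransform (2 / Real.pi)).add
    (tendstoUniformlyOn_smul_const hM hsinc)).add (tendstoUniformlyOn_finset_sum (Finset.range k)
      fun j hj => (hder j (Finset.mem_range.1 hj)).tendstoUniformlyOn_smul_sineTransform
        (2 * (lowerSymbol k 1).coeff (j + 1) / (Real.pi * (2 * k).factorial)))
  refine (hlim.congr ?_).congr_right fun x _ => by simp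
  filter_upwards [eventually_ge_atTop 0] with R hR x hx
  exact (fourierPartial_eq_sineTransform hF_int hF_diff hδ.le
    (hdini.1 _ (mem_image_of_mem _ hx)) (fun j hj => (hder j hj).1 _ (mem_image_of_mem _ hx))
    (hdecay x hx) hR).symm

end Main

theorem mainTheorem6 {X : Type*} [NormedAddCommGroup X] [NormedSpace ℂ X] [CompleteSpace X]
    (n k : ℕ) (hk : 1 ≤ k) (hn : n = 2 * k + 1)
    (K : Set (EuclideanSpace ℝ (Fin n))) (hK : IsCompact K)
    (F : EuclideanSpace ℝ (Fin n) → X)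
    (hF_int : Integrable F) (hF_diff : ContDiff ℝ k F)
    (δ : ℝ) (hδ : 0 < δ)
    (hcomp_zero : IsCompactInL1
      {g : ℝ → X | ∃ x ∈ K, g = fun r : ℝ =>
        r⁻¹ • (sphericalMean F x r - (Ioo 0 δ).indicator (fun _ => F x) r)})
    (hcomp_deriv : ∀ j : ℕ, 1 ≤ j → j ≤ k → IsCompactInL1
      {g : ℝ → X | ∃ x ∈ K, ∃ l : ℕ, l ≤ j ∧ g = fun r : ℝ =>
        r ^ (j - 1) • iteratedDeriv l (sphericalMean F x) r}) :
    FourierInversionUniformlyOn F K := by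
  subst hn
  refine mainTheorem6_general hδ hF_int hF_diff (hcomp_zero.isPrecompactInL1.mono ?_)
    (fun j hj => (hcomp_deriv (j + 1) (by omega) hj).isPrecompactInL1.mono ?_)
    fun x hx l hl => (hcomp_deriv k hk le_rfl).1 _ ⟨x, hx, l, hl.le, rfl⟩
  · rintro _ ⟨x, hx, rfl⟩
    exact ⟨x, hx, rfl⟩
  · rintro _ ⟨x, hx, rfl⟩
    exact ⟨x, hx, j + 1, le_rfl, rfl⟩
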